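/- For a word $w$ over an alphabet $\Sigma$ and an integer $m\ge 0$ let $i_m(w)$ and $t_m(w)$ be the prefix and the suffix of $w$ of length $m$ (or $w$ itself if $|w|<m$), and let $F_m(w)$ be the set of factors of $w$ of length $m$. For $k\ge 1$ write $u\equiv_k v$ if $i_{k-1}(u)=i_{k-1}(v)$, $t_{k-1}(u)=t_{k-1}(v)$ and $F_k(u)=F_k(v)$. A language $L$ over $\Sigma$ is $k$-testable if for all $u,v\in\Sigma^+$ with $u\equiv_k v$ we have $u\in L\iff v\in L$. A semigroup $S$ is $k$-testable if there are an alphabet $\Delta$ and a surjective morphism $\varphi:\Delta^+\to S$ such that $u\varphi=v\varphi$ for all $u,v\in\Delta^+$ with $u\equiv_k v$. A deterministic automaton (with a possibly partial transition function, an initial state and a set of accepting states) is called $k$-testable in the sense of languages if the language it accepts is $k$-testable, and in the sense of semigroups if its transition semigroup (the partial maps of the state set induced by nonempty words) is $k$-testable. In either sense it is locally testable if it is $k$-testable for some $k\ge1$; it is precisely $k$-testable, and $k$ is its order of local testability, if $k$ is the least positive integer for which it is $k$-testable. An automaton is reduced if every state is reachable from the initial state and distinct states accept distinct languages. Let $n>2$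 and let $\mathbf M$ be the automaton with states $\mathbf q_1,\dots,\mathbf q_n$ over the alphabet consisting of $a$ and of $b_{i,j}$ for $1\le i\le n-2$, $i<j\le n$, with transitions $$\mathbf q_3a=\mathbf q_1;\qquad \mathbf q_ib_{i,j}=\mathbf q_i,\quad \mathbf q_jb_{i,j}=\mathbf q_{j+1}\quad(1\le i\le n-2,\ i<j<n);\qquad \mathbf q_ib_{i,n}=\mathbf q_{i+1},\quad \mathbf q_nb_{i,n}=\mathbf q_{i+2}\quad(1\le i\le n-2),$$ and all other transitions undefined, with any initial state and any nonempty set of accepting states. **Theorem 6.3.** $\mathbf M$ is reduced, and, both in the sense of semigroups and in the sense of languages, $\mathbf M$ is locally testable and is precisely $\left(\frac{n^2-n}{2}+1\right)$-testable. This is the best possible upper bound for $n$ states: in each of the two senses, $\frac{n^2-n}{2}+1$ is the greatest order of local testability of a reduced locally testable deterministic automaton with $n$ states over a finite alphabet. -/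

import Mathlib

namespace LocalTestability

universe u v

/-! Words of `Σ⁺` are elements of `FreeSemigroup Σ`, or nonempty lists of letters. -/

/-- The list of letters of a nonempty word. -/
def letters {α : Type u} (w : FreeSemigroup α) : List α := w.head :: w.tail

/-- `F_k(w)`: the set of factors of `w` of length `k`. -/
def factors {α : Type u} (k : ℕ) (w : List α) : Set (List α) :=
  {x | x.length = k ∧ x <:+: w}

/-- `u` and `v` have the same prefix of length `k - 1`, the same suffix of length `k - 1`
(the whole word, if it is shorter), and the same factors of length `k`.
Only used for `k ≥ 1`. -/
def TestEquiv {α : Type u} (k : ℕ) (u v : List α) : Prop :=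
  u.take (k - 1) = v.take (k - 1) ∧ u.rtake (k - 1) = v.rtake (k - 1) ∧
    factors k u = factors k v

/-- A `k`-testable language, `k` a positive integer. Only nonempty words are compared. -/
def LanguageTestable {α : Type u} (L : Language α) (k : ℕ) : Prop :=
  1 ≤ k ∧ ∀ u v : List α, u ≠ [] → v ≠ [] → TestEquiv k u v → (u ∈ L ↔ v ∈ L)

/-- A `k`-testable semigroup, `k` a positive integer. -/
def SemigroupTestable (S : Type u) [Semigroup S] (k : ℕ) : Prop :=
  1 ≤ k ∧ ∃ (α : Type u) (φ : FreeSemigroup α →ₙ* S), Function.Surjective φ ∧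
    ∀ u v : FreeSemigroup α, TestEquiv k (letters u) (letters v) → φ u = φ v

/-- A deterministic automaton whose transition function may be partial
(`none` means undefined). -/
structure Automaton (α : Type u) (Q : Type v) where
  /-- the transition function -/
  step : Q → α → Option Q
  /-- the initial state -/
  start : Q
  /-- the accepting states -/
  accept : Set Q

namespace Automaton

variable {α : Type u} {Q : Type v}

/-- The state `p w`, if it is defined. -/
def run (A : Automaton α Q) : Q → List α → Option Q
  | p, [] => some p
  | p, x :: w => (A.step p x).bind fun q => A.run q w

theorem run_append (A : Automaton α Q) (p : Q) (u v : List α) :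
    A.run p (u ++ v) = (A.run p u).bind fun q => A.run q v := by
  induction u generalizing p with
  | nil => rfl
  | cons x u ih =>
    simp only [List.cons_append, run]
    cases A.step p x with
    | none => rfl
    | some q => exact ih q

/-- The words accepted from the state `p`. -/
def acceptsFrom (A : Automaton α Q) (p : Q) : Language α :=
  {w | ∃ q ∈ A.accept, A.run p w = some q}

/-- The language accepted by the automaton. -/
def language (A : Automaton α Q) : Language α := A.acceptsFrom A.start

/-- A reduced automaton: every state is reachable from the initial state, and distinct
states are inequivalent. -/
def IsReduced (A : Automaton α Q) : Prop :=
  (∀ q, ∃ w, A.run A.start w = some q) ∧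
    ∀ p q, A.acceptsFrom p = A.acceptsFrom q → p = q

/-- Two nonempty words are identified if they act in the same way, as partial maps,
on the states. -/
def transitionCon (A : Automaton α Q) : Con (FreeSemigroup α) where
  r u v := ∀ p, A.run p (letters u) = A.run p (letters v)
  iseqv := ⟨fun _ _ => rfl, fun h p => (h p).symm, fun h h' p => (h p).trans (h' p)⟩
  mul' := by
    intro a b c d hab hcd p
    have key : ∀ x y : FreeSemigroup α, letters (x * y) = letters x ++ letters y :=
      fun _ _ => rfl
    rw [key, key, run_append, run_append, hab p]
    congr 1
    funext q
    exact hcd q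

/-- The transition semigroup: the semigroup, under composition, of the partial maps
on the states that are induced by nonempty words. -/
abbrev TransitionSemigroup (A : Automaton α Q) : Type u := A.transitionCon.Quotient

/-- `k`-testability of an automaton, through its semigroup. -/
def Testable (A : Automaton α Q) (k : ℕ) : Prop :=
  SemigroupTestable A.TransitionSemigroup k

/-- `k`-testability of an automaton, through its language. -/
def AcceptsTestable (A : Automaton α Q) (k : ℕ) : Prop :=
  LanguageTestable A.language k

/-- Local testability of an automaton, through its semigroup. -/
def LocallyTestable (A : Automaton α Q) : Prop := ∃ k, A.Testable k

/-- Local testability of an automaton, through its language. -/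
def AcceptsLocallyTestable (A : Automaton α Q) : Prop := ∃ k, A.AcceptsTestable k

/-- The automaton is precisely `k`-testable: its order of local testability is `k`. -/
def PreciselyTestable (A : Automaton α Q) (k : ℕ) : Prop := IsLeast {j | A.Testable j} k

/-- As `PreciselyTestable`, for the language of the automaton. -/
def AcceptsPreciselyTestable (A : Automaton α Q) (k : ℕ) : Prop :=
  IsLeast {j | A.AcceptsTestable j} k

end Automaton

/-! The automaton `M`. The element `k` of `Fin n` stands for the state `q_{k+1}`. -/

/-- The alphabet of `M`: a letter `a` and letters `b_{i,j}` for `1 ≤ i ≤ n - 2`, `i < j ≤ n`.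
Here `b i j` is `b_{i+1,j+1}`. -/
inductive Letter (n : ℕ) : Type
  | a : Letter n
  | b (i j : Fin n) (hi : i.val + 2 < n) (hij : i < j) : Letter n

/-- The transitions of `M`:
`q_3 a = q_1`;
`q_i b_{i,j} = q_i` and `q_j b_{i,j} = q_{j+1}` if `j < n`;
`q_i b_{i,n} = q_{i+1}` and `q_n b_{i,n} = q_{i+2}`;
all others are undefined. -/
def stepM (n : ℕ) : Fin n → Letter n → Option (Fin n)
  | k, .a => if k.val = 2 then some ⟨0, k.pos⟩ else none
  | k, .b i j hi _ =>
    if hj : j.val + 1 < n then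
      if k = i then some i
      else if k = j then some ⟨j.val + 1, hj⟩
      else none
    else
      if k = i then some ⟨i.val + 1, by omega⟩
      else if k = j then some ⟨i.val + 2, hi⟩
      else none

/-- The automaton `M` with `n` states, with initial state `s` and accepting states `F`. -/
def M (n : ℕ) (s : Fin n) (F : Set (Fin n)) : Automaton (Letter n) (Fin n) where
  step := stepM n
  start := s
  accept := F

end LocalTestability

/-! Both senses of testability reduce to `ActionTestable`: test-equivalent nonempty words act alike
on the states, with `none` as a sink. For semigroups this is `testable_iff`, as nonerasing
substitutions preserve test equivalence; for languages of reduced automata it is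
`acceptsTestable_iff`, once transitions into dead states are cut. Put K = `n.choose 2`.

Upper bound. A word is a path in the de Bruijn graph with words of length K as vertices and words of
length K + 1 as edges. By Simon's theorem (`eq_of_factors_eq`), a right-invariant function of paths
depends only on the two ends and the set of edges, provided that loops at a vertex are idempotent
and commute. For the action on states this is `act_loop_idem` and `act_loop_comm`. Distinct
trajectories along a word of length K show K + 1 pairs of states, so a pair repeats and yields a
common loop or a swap. Testability of any order forbids swaps (`eq_of_swap`) and common loops of
distinct states of one strong component (`eq_of_fixed`).

Sharpness. In `M`, a letter defined on two states sends their pair to its lexicographic successor.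
Hence a word of length K is defined on at most one state, and loops after it act trivially or lead
to the sink. A word `w` of length K - 1 runs through all pairs, and for a suitable `g` the words
`wgw` and `wgwgw` act differently (`M_not_actionTestable`). -/

namespace LocalTestability

universe u v

/-! ### Factors, test equivalence and powers of words. -/

section Words

variable {α : Type u}

/-- A window of length at most `e.length + 1` cannot stick out of `e` on both sides. -/
theorem infix_overlap {x p e q : List α} (h : x <:+: p ++ e ++ q) (hx : x.length ≤ e.length + 1) :
    x <:+: p ++ e ∨ x <:+: e ++ q := by
  obtain ⟨s, t, h⟩ := h
  rcases le_or_gt p.length s.length with hl | hl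
  · right
    have h1 : p <+: s := List.prefix_of_prefix_length_le (l₃ := p ++ e ++ q)
      (by simp) (h ▸ by simp) hl
    obtain ⟨s', rfl⟩ := h1
    exact ⟨s', t, by simpa using h⟩
  · left
    have h1 : s ++ x <+: p ++ e := List.prefix_of_prefix_length_le (l₃ := p ++ e ++ q)
      (h ▸ by simp) (by simp) (by simp; omega)
    obtain ⟨t', ht⟩ := h1
    exact ⟨s, t', ht⟩

theorem factors_mono {k : ℕ} {w w' : List α} (h : w <:+: w') : factors k w ⊆ factors k w' :=
  fun _ hx => ⟨hx.1, hx.2.trans h⟩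

theorem factors_overlap {k : ℕ} (p q : List α) {e : List α} (he : k ≤ e.length + 1) :
    factors k (p ++ e ++ q) = factors k (p ++ e) ∪ factors k (e ++ q) := by
  apply Set.Subset.antisymm
  · rintro x ⟨hx, hi⟩
    rcases infix_overlap hi (by omega) with h | h
    · exact Or.inl ⟨hx, h⟩
    · exact Or.inr ⟨hx, h⟩
  · apply Set.union_subset
    · exact factors_mono (List.prefix_append _ _).isInfix
    · exact factors_mono (by rw [List.append_assoc]; exact (List.suffix_append _ _).isInfix)

theorem suffix_append_of_suffix {v w v' g : List α} (h : v <:+ w) (h' : v' <:+ v ++ g) :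
    v' <:+ w ++ g := by
  obtain ⟨t, rfl⟩ := h
  rw [List.append_assoc]
  exact h'.trans (List.suffix_append _ _)

/-- New factors reach back at most K letters, so only the end vertex `v` of the path `w` matters. -/
theorem factors_append {K : ℕ} {v w : List α} (hv : v.length = K) (h : v <:+ w) (g : List α) :
    factors (K + 1) (w ++ g) = factors (K + 1) w ∪ factors (K + 1) (v ++ g) := by
  obtain ⟨t, rfl⟩ := h
  exact factors_overlap t g (by omega)

theorem take_append_eq {k : ℕ} {e : List α} (q : List α) (he : k ≤ e.length) :
    (e ++ q).take k = e.take k := by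
  rw [List.take_append_of_le_length he]

theorem rtake_append_eq {k : ℕ} {e : List α} (p : List α) (he : k ≤ e.length) :
    (p ++ e).rtake k = e.rtake k := by
  unfold List.rtake
  rw [List.length_append, Nat.add_sub_assoc he, List.drop_append, List.drop_eq_nil_of_le (by omega)]
  simp

/-- Words that share the prefix `e` and the suffix `e'` and whose factors agree. -/
theorem testEquiv_of_factors {k : ℕ} {e e' x y x' y' : List α} (he : k ≤ e.length + 1)
    (he' : k ≤ e'.length + 1) (h1 : e ++ x = y ++ e') (h2 : e ++ x' = y' ++ e')
    (hf : factors k (e ++ x) = factors k (e ++ x')) : TestEquiv k (e ++ x) (e ++ x') := by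
  refine ⟨?_, ?_, hf⟩
  · rw [take_append_eq _ (by omega), take_append_eq _ (by omega)]
  · rw [h1, h2, rtake_append_eq _ (by omega), rtake_append_eq _ (by omega)]

theorem factors_eq_empty {k : ℕ} {w : List α} (h : w.length < k) : factors k w = ∅ := by
  ext x
  simp only [factors, Set.mem_ofPred_eq, Set.mem_empty_iff_false, iff_false, not_and]
  intro hx hi
  have := hi.length_le
  omega

theorem take_mem_factors {k : ℕ} {w : List α} (h : k ≤ w.length) : w.take k ∈ factors k w :=
  ⟨by simpa using h, (List.take_prefix _ _).isInfix⟩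

theorem TestEquiv.symm {k : ℕ} {p q : List α} (h : TestEquiv k p q) : TestEquiv k q p :=
  ⟨h.1.symm, h.2.1.symm, h.2.2.symm⟩

theorem TestEquiv.length_lt_imp {k : ℕ} (hk : 1 ≤ k) {p q : List α} (h : TestEquiv k p q)
    (hp : p.length < k) : p = q := by
  have hq : q.length < k := by
    by_contra hq
    have := take_mem_factors (not_lt.1 hq)
    rw [← h.2.2, factors_eq_empty hp] at this
    exact this
  have := h.1
  rwa [List.take_of_length_le (by omega), List.take_of_length_le (by omega)] at this

theorem TestEquiv.eq_or {k : ℕ} (hk : 1 ≤ k) {p q : List α} (h : TestEquiv k p q) :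
    p = q ∨ (k ≤ p.length ∧ k ≤ q.length) := by
  by_cases hp : p.length < k
  · exact Or.inl (h.length_lt_imp hk hp)
  · by_cases hq : q.length < k
    · exact Or.inl (h.symm.length_lt_imp hk hq).symm
    · exact Or.inr ⟨by omega, by omega⟩

theorem rtake_suffix (k : ℕ) (w : List α) : w.rtake k <:+ w := List.drop_suffix _ _

theorem length_rtake {k : ℕ} {w : List α} (h : k ≤ w.length) : (w.rtake k).length = k := by
  simp [List.rtake]; omega

/-- `TestEquiv` is a congruence. -/
theorem TestEquiv.append {k : ℕ} (hk : 1 ≤ k) {p q : List α} (h : TestEquiv k p q)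
    (x y : List α) : TestEquiv k (x ++ p ++ y) (x ++ q ++ y) := by
  rcases h.eq_or hk with rfl | ⟨hp, hq⟩
  · exact ⟨rfl, rfl, rfl⟩
  obtain ⟨K, rfl⟩ : ∃ K, k = K + 1 := ⟨k - 1, by omega⟩
  obtain ⟨h1, h2, h3⟩ := h
  simp only [Nat.add_sub_cancel] at h1 h2
  obtain ⟨p', hp'⟩ := List.take_prefix K p
  obtain ⟨q', hq'⟩ := List.take_prefix K q
  obtain ⟨p'', hp''⟩ := rtake_suffix K p
  obtain ⟨q'', hq''⟩ := rtake_suffix K q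
  have lp : (p.take K).length = K := by simp; omega
  have lr : (p.rtake K).length = K := length_rtake (by omega)
  rw [← h1] at hq'
  rw [← h2] at hq''
  generalize p.take K = c at *
  generalize p.rtake K = d at *
  have key : ∀ r r' r'' : List α, c ++ r' = r → r'' ++ d = r →
      factors (K + 1) (x ++ r ++ y) =
        factors (K + 1) (x ++ c) ∪ factors (K + 1) r ∪ factors (K + 1) (d ++ y) := by
    intro r r' r'' hr hr'
    have e1 : x ++ r = x ++ c ++ r' := by rw [← hr]; simp
    rw [factors_append (v := d) lr ⟨x ++ r'', by rw [← hr']; simp⟩, e1,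
      factors_append (v := c) lp ⟨x, rfl⟩, hr]
  have hE := key p p' p'' hp' hp''
  rw [h3, ← key q q' q'' hq' hq''] at hE
  have e1 : x ++ p ++ y = (x ++ c) ++ (p' ++ y) := by rw [← hp']; simp
  have e2 : x ++ q ++ y = (x ++ c) ++ (q' ++ y) := by rw [← hq']; simp
  rw [e1, e2] at hE ⊢
  refine testEquiv_of_factors (e' := d ++ y) (y := x ++ p'') (y' := x ++ q'') (by simp; omega)
    (by simp; omega) ?_ ?_ hE
  · rw [← e1, ← hp'']; simp
  · rw [← e2, ← hq'']; simp

/-- The power `x ^ m` of a word. -/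
def wpow (x : List α) : ℕ → List α
  | 0 => []
  | m + 1 => x ++ wpow x m

theorem wpow_succ' (x : List α) (m : ℕ) : wpow x (m + 1) = wpow x m ++ x := by
  induction m with
  | zero => simp [wpow]
  | succ m ih => rw [wpow, ih, ← List.append_assoc, ← wpow, ih]

theorem le_length_wpow {x : List α} (hx : x ≠ []) (m : ℕ) : m ≤ (wpow x m).length := by
  induction m with
  | zero => simp
  | succ m ih =>
    have := List.length_pos_of_ne_nil hx
    simp [wpow]; omega

theorem wpow_conj {s s' w : List α} (h : s' ++ w = w ++ s) (m : ℕ) :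
    wpow s' m ++ w = w ++ wpow s m := by
  induction m with
  | zero => simp [wpow]
  | succ m ih => rw [wpow, List.append_assoc, ih, ← List.append_assoc, h, wpow, List.append_assoc]

/-- Moving the occurrence of a loop along a word. -/
theorem exists_conj {s s' w₁ h : List α} (e : s' ++ (w₁ ++ h) = w₁ ++ h ++ s) :
    ∃ z, s' ++ w₁ = w₁ ++ z ∧ z ++ h = h ++ s ∧ z.length = s'.length := by
  have h1 : w₁ <+: s' ++ w₁ := List.prefix_of_prefix_length_le (l₃ := w₁ ++ h ++ s)
    (by simp) (e ▸ by simp) (by simp)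
  obtain ⟨z, hz⟩ := h1
  refine ⟨z, hz.symm, ?_, ?_⟩
  · rw [← List.append_assoc, ← hz] at e
    simpa using e
  · have := congrArg List.length hz
    simp at this; omega

/-- The relation makes `h` a prefix of every `z ^ m h`, and `h.length` copies of the nonempty `z`
cover it. -/
theorem exists_wpow_eq_append {z h s : List α} (e : z ++ h = h ++ s) (hz : z ≠ []) :
    ∃ t, wpow z h.length = h ++ t := by
  have h1 : h <+: wpow z h.length := List.prefix_of_prefix_length_le
    (l₃ := h ++ wpow s h.length) (by simp) (wpow_conj e h.length ▸ by simp) (le_length_wpow hz _)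
  obtain ⟨t, ht⟩ := h1
  exact ⟨t, ht.symm⟩

/-- The source of aperiodicity: the overlap `x ^ (j - 1)` already has length at least `j - 1`. -/
theorem testEquiv_wpow_succ {x : List α} (hx : x ≠ []) {j : ℕ} (hj : 1 ≤ j) :
    TestEquiv j (wpow x j) (wpow x (j + 1)) := by
  obtain ⟨m, rfl⟩ : ∃ m, j = m + 1 := ⟨j - 1, by omega⟩
  have hl := le_length_wpow hx m
  have e1 : wpow x (m + 1) = wpow x m ++ x := wpow_succ' x m
  have e2 : wpow x (m + 1 + 1) = wpow x m ++ (x ++ x) := by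
    rw [wpow_succ', wpow_succ', List.append_assoc]
  have e3 : wpow x (m + 1 + 1) = x ++ wpow x m ++ x := by
    rw [wpow, wpow_succ', List.append_assoc]
  have hf : factors (m + 1) (wpow x (m + 1)) = factors (m + 1) (wpow x (m + 1 + 1)) := by
    rw [e3, factors_overlap _ _ (by omega), ← wpow_succ', ← wpow, Set.union_self]
  rw [e1, e2] at hf ⊢
  exact testEquiv_of_factors (e' := wpow x m) (y := x) (y' := x ++ x) (by omega) (by omega)
    (by rw [← wpow_succ', wpow])
    (by rw [← e2, wpow, wpow, List.append_assoc]) hf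

/-- No window of length `j` sees past both ends of `e`, so a second passage through `g` shows
nothing new. -/
theorem testEquiv_idem {e : List α} {j : ℕ} (he : j ≤ e.length + 1) (g : List α) :
    TestEquiv j (e ++ (g ++ e)) (e ++ (g ++ e ++ g ++ e)) := by
  refine testEquiv_of_factors (e' := e) (y := e ++ g) (y' := e ++ g ++ e ++ g) (by omega)
    (by omega) (by simp) (by simp) ?_
  have : e ++ (g ++ e ++ g ++ e) = (e ++ g) ++ e ++ (g ++ e) := by simp
  rw [this, factors_overlap _ _ (by omega), List.append_assoc, Set.union_self]

theorem testEquiv_comm {e : List α} {j : ℕ} (he : j ≤ e.length + 1) (g h : List α) :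
    TestEquiv j (e ++ (g ++ e ++ h ++ e)) (e ++ (h ++ e ++ g ++ e)) := by
  refine testEquiv_of_factors (e' := e) (y := e ++ g ++ e ++ h) (y' := e ++ h ++ e ++ g) (by omega)
    (by omega) (by simp) (by simp) ?_
  have key : ∀ g h : List α, factors j (e ++ (g ++ e ++ h ++ e)) =
      factors j (e ++ (g ++ e)) ∪ factors j (e ++ (h ++ e)) := by
    intro g h
    have e1 : e ++ (g ++ e ++ h ++ e) = (e ++ g) ++ e ++ (h ++ e) := by simp
    rw [e1, factors_overlap _ _ (by omega), List.append_assoc]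
  rw [key, key, Set.union_comm]

end Words

/-! ### Simon's theorem on paths in the de Bruijn graph. -/

/-- A function of words that is invariant under the repetition and the transposition of the loops
at the end of a word, in the de Bruijn graph whose vertices are the words of length `K`. -/
structure LoopInvariant {α : Type u} {X : Type v} (K : ℕ) (Φ : List α → X) : Prop where
  cong : ∀ {w w' : List α}, Φ w = Φ w' → ∀ g, Φ (w ++ g) = Φ (w' ++ g)
  idem : ∀ {w v g : List α}, v.length = K → v <:+ w → v <:+ v ++ g → Φ (w ++ g ++ g) = Φ (w ++ g)
  comm : ∀ {w v g h : List α}, v.length = K → v <:+ w → v <:+ v ++ g → v <:+ v ++ h →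
    Φ (w ++ g ++ h) = Φ (w ++ h ++ g)

namespace LoopInvariant

variable {α : Type u} {X : Type v} {K : ℕ} {Φ : List α → X}

theorem factors_append_subset {w v g : List α} {S : Set (List α)} (hv : v.length = K)
    (h : v <:+ w) (h1 : factors (K + 1) w ⊆ S) (h2 : factors (K + 1) (v ++ g) ⊆ S) :
    factors (K + 1) (w ++ g) ⊆ S := by
  rw [factors_append hv h]
  exact Set.union_subset h1 h2

theorem subset_factors_append {w v : List α} (h : v <:+ w) (g : List α) :
    factors (K + 1) (v ++ g) ⊆ factors (K + 1) (w ++ g) := by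
  obtain ⟨t, rfl⟩ := h
  rw [List.append_assoc]
  exact factors_mono (List.suffix_append _ _).isInfix

theorem rtake_append_congr {w w' v : List α} (hv : v.length = K) (h : v <:+ w) (h' : v <:+ w')
    (g : List α) : (w ++ g).rtake K = (w' ++ g).rtake K := by
  obtain ⟨t, rfl⟩ := h
  obtain ⟨t', rfl⟩ := h'
  rw [List.append_assoc, List.append_assoc, rtake_append_eq t (by simp; omega),
    rtake_append_eq t' (by simp; omega)]

theorem exists_end {w : List α} (h : K ≤ w.length) : ∃ v, v.length = K ∧ v <:+ w :=
  ⟨_, length_rtake h, rtake_suffix _ _⟩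

/-- From the earlier occurrence of the edge, the rest of `w` is a loop at `v`; idempotence lets it
be run again, so an old edge can always be undone. -/
theorem exists_return_letter (H : LoopInvariant K Φ) {w v : List α} {a : α} (hv : v.length = K)
    (h : v <:+ w) (ha : v ++ [a] <:+: w) :
    ∃ r, v <:+ v ++ a :: r ∧ factors (K + 1) (w ++ a :: r) ⊆ factors (K + 1) w ∧
      Φ (w ++ a :: r) = Φ w := by
  obtain ⟨p, r, rfl⟩ := ha
  have hs : v ++ a :: r <:+ p ++ (v ++ [a]) ++ r := ⟨p, by simp⟩
  have hloop : v <:+ v ++ a :: r := List.suffix_of_suffix_length_le h hs (by simp)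
  refine ⟨r, hloop, ?_, ?_⟩
  · exact factors_append_subset hv h subset_rfl (factors_mono hs.isInfix)
  · have := H.idem (w := p ++ v) hv (List.suffix_append _ _) hloop
    simpa using this

/-- Old edges are undone one at a time, the last one first. -/
theorem exists_return (H : LoopInvariant K Φ) {w v : List α} (hv : v.length = K) (h : v <:+ w)
    (x : List α) (hx : factors (K + 1) (w ++ x) ⊆ factors (K + 1) w) {v' : List α}
    (hv' : v'.length = K) (h' : v' <:+ w ++ x) :
    ∃ r, v <:+ v' ++ r ∧ factors (K + 1) (w ++ x ++ r) ⊆ factors (K + 1) w ∧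
      Φ (w ++ x ++ r) = Φ w := by
  induction x using List.reverseRecOn generalizing v' with
  | nil =>
    refine ⟨[], ?_, by simp, by simp⟩
    rw [List.append_nil] at h' ⊢
    exact List.suffix_of_suffix_length_le h h' (by omega)
  | append_singleton x a ih =>
    have hw := h.length_le
    obtain ⟨v₁, hv₁, h₁⟩ := exists_end (K := K) (w := w ++ x) (by simp; omega)
    have hx' : factors (K + 1) (w ++ x) ⊆ factors (K + 1) w :=
      (factors_mono (by rw [← List.append_assoc]; exact (List.prefix_append _ _).isInfix)).trans hx
    obtain ⟨r', hr1, hr2, hr3⟩ := ih hx' hv₁ h₁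
    have hs : v₁ ++ [a] <:+ w ++ (x ++ [a]) := by
      rw [← List.append_assoc]
      exact suffix_append_of_suffix h₁ (List.suffix_refl _)
    have hmem : v₁ ++ [a] ∈ factors (K + 1) w := hx ⟨by simp [hv₁], hs.isInfix⟩
    obtain ⟨r, hl1, hl2, hl3⟩ := H.exists_return_letter hv₁ h₁
      (hmem.2.trans (List.prefix_append _ _).isInfix)
    have e : w ++ (x ++ [a]) ++ (r ++ r') = (w ++ x ++ a :: r) ++ r' := by simp
    have hv'a : v' <:+ v₁ ++ [a] := List.suffix_of_suffix_length_le h' hs (by simp; omega)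
    have hv₁' : v₁ <:+ v' ++ r := by
      refine List.suffix_of_suffix_length_le (l₃ := v₁ ++ a :: r) hl1 ?_ (by simp; omega)
      obtain ⟨t, ht⟩ := hv'a
      refine ⟨t, ?_⟩
      rw [← List.append_assoc, ht]; simp
    refine ⟨r ++ r', ?_, ?_, ?_⟩
    · rw [← List.append_assoc]
      exact suffix_append_of_suffix hv₁' hr1
    · rw [e]
      exact factors_append_subset hv₁ (suffix_append_of_suffix h₁ hl1) (hl2.trans hx')
        ((subset_factors_append h₁ _).trans hr2)
    · rw [e, H.cong hl3, hr3]

/-- A return path `r` for `x` is itself a loop, so it commutes with a second copy of `x`;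
idempotence deletes that copy and `r` undoes the other. -/
theorem absorb (H : LoopInvariant K Φ) {w v x : List α} (hv : v.length = K) (h : v <:+ w)
    (hl : v <:+ v ++ x) (hx : factors (K + 1) (w ++ x) ⊆ factors (K + 1) w) :
    Φ (w ++ x) = Φ w := by
  have hwx : v <:+ w ++ x := suffix_append_of_suffix h hl
  obtain ⟨r, hr1, -, hr3⟩ := H.exists_return hv h x hx hv hwx
  calc Φ (w ++ x) = Φ (w ++ x ++ r ++ x) := (H.cong hr3 x).symm
    _ = Φ (w ++ x ++ x ++ r) := H.comm hv hwx hr1 hl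
    _ = Φ (w ++ x ++ r) := H.cong (H.idem hv h hl) r
    _ = Φ w := hr3

theorem absorb_middle (H : LoopInvariant K Φ) {w v x : List α} (hv : v.length = K) (h : v <:+ w)
    (hl : v <:+ v ++ x) (u : List α)
    (hx : factors (K + 1) (w ++ x ++ u) ⊆ factors (K + 1) (w ++ u)) :
    Φ (w ++ x ++ u) = Φ (w ++ u) := by
  have hwx : v <:+ w ++ x := suffix_append_of_suffix h hl
  induction u using List.reverseRecOn with
  | nil => simp only [List.append_nil] at hx ⊢; exact H.absorb hv h hl hx
  | append_singleton u a ih =>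
    by_cases hs : factors (K + 1) (w ++ x ++ u) ⊆ factors (K + 1) (w ++ u)
    · rw [← List.append_assoc, ← List.append_assoc, H.cong (ih hs)]
    -- The induction stops only if `a` completes an edge `f` that lies on `x` but not on `w ++ u`.
    -- The part `r` of `x` after `f` then leads from the end of `y` back to `v`. This makes `y ++ r`
    -- a loop at `v`, which can be inserted, commuted with `x`, used to absorb `x`, and removed.
    obtain ⟨f, hf, hf'⟩ := Set.not_subset.1 hs
    have hwl := h.length_le
    obtain ⟨v₁, hv₁, h₁⟩ := exists_end (K := K) (w := v ++ u) (by simp; omega)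
    have hvu : v₁ <:+ w ++ u := suffix_append_of_suffix h h₁
    have hmem : f ∈ factors (K + 1) (w ++ (u ++ [a])) := by
      apply hx
      refine factors_mono ?_ hf
      rw [← List.append_assoc]
      exact (List.prefix_append _ _).isInfix
    have hfe : f = v₁ ++ [a] := by
      rw [← List.append_assoc, factors_append hv₁ hvu] at hmem
      obtain ⟨hl, hi⟩ := hmem.resolve_left hf'
      exact hi.eq_of_length (by simp; omega)
    have hfx : f <:+: v ++ x := by
      rw [factors_append hv hwx, factors_append hv h] at hf
      rcases hf with (hf | hf) | hf
      · exact absurd (factors_mono (List.prefix_append _ _).isInfix hf) hf'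
      · exact hf.2
      · exact absurd (subset_factors_append h _ hf) hf'
    obtain ⟨p, r, hr⟩ := hfx
    set y := u ++ [a] with hy
    obtain ⟨v₂, hv₂, h₂⟩ := exists_end (K := K) (w := f) (by simp [hfe]; omega)
    have hfy : f <:+ w ++ y := by
      rw [hy, hfe, ← List.append_assoc]
      exact suffix_append_of_suffix hvu (List.suffix_refl _)
    have hfvy : f <:+ v ++ y := by
      rw [hy, hfe, ← List.append_assoc]
      exact suffix_append_of_suffix h₁ (List.suffix_refl _)
    have hvfr : v <:+ f ++ r := by
      refine List.suffix_of_suffix_length_le (l₃ := v ++ x) hl ?_ (by simp [hfe]; omega)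
      exact ⟨p, by rw [← hr, List.append_assoc]⟩
    have hv₂r : v <:+ v₂ ++ r := by
      obtain ⟨t, ht⟩ := h₂
      refine List.suffix_of_suffix_length_le hvfr ?_ (by simp; omega)
      exact ⟨t, by rw [← ht, List.append_assoc]⟩
    have h₂y : v₂ <:+ v ++ y := h₂.trans hfvy
    have h₂wy : v₂ <:+ w ++ y := h₂.trans hfy
    have hyr : v <:+ v ++ (y ++ r) := by
      rw [← List.append_assoc]; exact suffix_append_of_suffix h₂y hv₂r
    have hry : v₂ <:+ v₂ ++ (r ++ y) := by
      rw [← List.append_assoc]; exact suffix_append_of_suffix hv₂r h₂y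
    have Fvx : factors (K + 1) (v ++ x) ⊆ factors (K + 1) (w ++ y) :=
      (subset_factors_append h _).trans
        ((factors_mono (List.prefix_append _ _).isInfix).trans hx)
    have Ffr : factors (K + 1) (v₂ ++ r) ⊆ factors (K + 1) (w ++ y) := by
      refine (subset_factors_append h₂ _).trans ((factors_mono ?_).trans Fvx)
      rw [← hr, List.append_assoc]
      exact (List.suffix_append _ _).isInfix
    have Fvy : factors (K + 1) (v ++ y) ⊆ factors (K + 1) (w ++ y) := subset_factors_append h _
    have Fwyr : factors (K + 1) (w ++ y ++ r) ⊆ factors (K + 1) (w ++ y) :=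
      factors_append_subset hv₂ h₂wy subset_rfl Ffr
    have Fry : factors (K + 1) (v₂ ++ (r ++ y)) ⊆ factors (K + 1) (w ++ y) := by
      rw [← List.append_assoc]
      exact factors_append_subset hv hv₂r Ffr Fvy
    have hwyr : v <:+ w ++ y ++ r := suffix_append_of_suffix h₂wy hv₂r
    have hwxy : v₂ <:+ w ++ x ++ y := suffix_append_of_suffix hwx h₂y
    have s1 : Φ (w ++ y ++ (r ++ y)) = Φ (w ++ y) :=
      H.absorb hv₂ h₂wy hry (factors_append_subset hv₂ h₂wy subset_rfl Fry)
    have s2 : Φ (w ++ (y ++ r) ++ x) = Φ (w ++ (y ++ r)) := by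
      refine H.absorb hv (by rw [← List.append_assoc]; exact hwyr) hl ?_
      rw [← List.append_assoc]
      refine factors_append_subset hv hwyr subset_rfl (Fvx.trans ?_)
      exact factors_mono (List.prefix_append _ _).isInfix
    have Fwy : factors (K + 1) (w ++ y) ⊆ factors (K + 1) (w ++ x ++ y) := by
      rw [factors_append hv h, factors_append hv hwx]
      exact Set.union_subset_union_left _ (factors_mono (List.prefix_append _ _).isInfix)
    have s3 : Φ (w ++ x ++ y ++ (r ++ y)) = Φ (w ++ x ++ y) :=
      H.absorb hv₂ hwxy hry (factors_append_subset hv₂ hwxy subset_rfl (Fry.trans Fwy))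
    calc Φ (w ++ x ++ y) = Φ (w ++ x ++ (y ++ r) ++ y) := by rw [← s3]; simp
      _ = Φ (w ++ (y ++ r) ++ x ++ y) := H.cong (H.comm hv h hl hyr) y
      _ = Φ (w ++ (y ++ r) ++ y) := H.cong s2 y
      _ = Φ (w ++ y) := by rw [← s1]; simp

/-- Simon's theorem on coterminal paths with the same edges. -/
theorem eq_of_factors_eq (H : LoopInvariant K Φ) {w v x y : List α} (hv : v.length = K)
    (h : v <:+ w) (hxy : (w ++ x).rtake K = (w ++ y).rtake K)
    (hf : factors (K + 1) (w ++ x) = factors (K + 1) (w ++ y)) : Φ (w ++ x) = Φ (w ++ y) := by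
  induction x generalizing w v y with
  | nil =>
    rw [List.append_nil] at hxy hf ⊢
    refine (H.absorb hv h ?_ hf.ge).symm
    have hw := h.length_le
    have h1 : v <:+ w ++ y := by
      have : v = w.rtake K := (List.suffix_of_suffix_length_le h (rtake_suffix K w)
        (by rw [length_rtake (by omega)]; omega)).eq_of_length
          (by rw [length_rtake (by omega)]; omega)
      rw [this, hxy]
      exact rtake_suffix _ _
    exact List.suffix_of_suffix_length_le h1 (suffix_append_of_suffix h (List.suffix_refl _))
      (by simp)
  | cons a x ih =>
    have hw := h.length_le
    have hmem : v ++ [a] ∈ factors (K + 1) (w ++ y) := by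
      rw [← hf]
      refine ⟨by simp [hv], ?_⟩
      obtain ⟨t, rfl⟩ := h
      exact ⟨t, x, by simp⟩
    have hva : ∀ w, v <:+ w → v ++ [a] <:+ w ++ [a] := fun w hw =>
      suffix_append_of_suffix hw (List.suffix_refl _)
    obtain ⟨v₁, hv₁, h₁⟩ := exists_end (K := K) (w := v ++ [a]) (by simp; omega)
    have hwa : ∀ z, w ++ a :: z = w ++ [a] ++ z := by simp
    rw [factors_append hv h] at hmem
    rcases hmem with hmem | hmem
    -- The edge is old: inserting the loop `a :: r` before `y` makes both continuations start with
    -- `a`.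
    · obtain ⟨r, hr1, hr2, hr3⟩ := H.exists_return_letter hv h hmem.2
      have e : w ++ [a] ++ (r ++ y) = w ++ a :: r ++ y := by simp
      have hwar := suffix_append_of_suffix h hr1
      rw [hwa, ← H.cong hr3, ← e]
      refine ih hv₁ (h₁.trans (hva w h)) ?_ ?_
      · rw [e, ← hwa, hxy]
        exact rtake_append_congr hv h hwar y
      · rw [e, ← hwa, hf, factors_append hv h, factors_append hv hwar]
        congr 1
        refine Set.Subset.antisymm ?_ hr2
        exact factors_mono (List.prefix_append _ _).isInfix
    -- The edge lies on `y`, after a loop `y₁` at `v`. All edges of `y₁` occur on `w ++ a :: x`, so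
    -- `absorb_middle` allows `y₁` to be inserted there.
    · obtain ⟨p, y₂, hp⟩ := hmem.2
      obtain ⟨y₁, hy₁⟩ : v <+: p ++ v := List.prefix_of_prefix_length_le (l₃ := v ++ y)
        (by simp) ⟨[a] ++ y₂, by rw [← hp]; simp⟩ (by simp)
      have hy : y = y₁ ++ a :: y₂ := by
        have : v ++ y = v ++ (y₁ ++ a :: y₂) := by
          rw [← hp, ← List.append_assoc v, hy₁]; simp
        simpa using this
      have hl : v <:+ v ++ y₁ := ⟨p, hy₁.symm⟩
      have hwy₁ := suffix_append_of_suffix h hl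
      have hF : factors (K + 1) (w ++ y₁ ++ a :: x) ⊆ factors (K + 1) (w ++ a :: x) := by
        refine factors_append_subset hv hwy₁ ?_ (subset_factors_append h _)
        rw [hf, hy, ← List.append_assoc]
        exact factors_mono (List.prefix_append _ _).isInfix
      have hF' : factors (K + 1) (w ++ a :: x) ⊆ factors (K + 1) (w ++ y₁ ++ a :: x) := by
        refine factors_append_subset hv h ?_ (subset_factors_append hwy₁ _)
        rw [List.append_assoc]
        exact factors_mono (List.prefix_append _ _).isInfix
      have e : w ++ y = w ++ y₁ ++ [a] ++ y₂ := by rw [hy]; simp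
      have e' : w ++ y₁ ++ a :: x = w ++ y₁ ++ [a] ++ x := by simp
      rw [← H.absorb_middle hv h hl _ hF, e, e']
      refine ih hv₁ (h₁.trans (hva _ hwy₁)) ?_ ?_
      · rw [← e, ← e', ← hxy]
        exact rtake_append_congr hv hwy₁ h _
      · rw [← e, ← e', ← hf]
        exact hF'.antisymm' hF

theorem eq_of_testEquiv (H : LoopInvariant K Φ) {x y : List α} (h : TestEquiv (K + 1) x y) :
    Φ x = Φ y := by
  rcases h.eq_or (by omega) with rfl | ⟨hx, hy⟩
  · rfl
  obtain ⟨h1, h2, h3⟩ := h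
  simp only [Nat.add_sub_cancel] at h1 h2
  obtain ⟨x', hx'⟩ := List.take_prefix K x
  obtain ⟨y', hy'⟩ := List.take_prefix K y
  have lx : (x.take K).length = K := by simp; omega
  rw [← h1] at hy'
  generalize x.take K = c at *
  subst hx' hy'
  exact H.eq_of_factors_eq lx (List.suffix_refl _) h2 h3

end LoopInvariant

/-! ### Repetitions among pairs of states. -/

section Pigeonhole

variable {Q : Type v} [Fintype Q]

theorem exists_pair_eq {a b : ℕ → Option Q} (hab : ∀ l ≤ (Fintype.card Q).choose 2, a l ≠ b l)
    (ha : ∀ l ≤ (Fintype.card Q).choose 2, a l ≠ none)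
    (hb : ∀ l ≤ (Fintype.card Q).choose 2, b l ≠ none) :
    ∃ l l', l < l' ∧ l' ≤ (Fintype.card Q).choose 2 ∧ s(a l, b l) = s(a l', b l') := by
  classical
  set K := (Fintype.card Q).choose 2 with hK
  have hcard : ((Finset.univ.erase (none : Option Q)).powersetCard 2).card <
      (Finset.range (K + 1)).card := by
    rw [Finset.card_powersetCard, Finset.card_erase_of_mem (Finset.mem_univ _), Finset.card_univ,
      Fintype.card_option, Finset.card_range]
    simp [hK]
  have key : ∀ l l', ({a l, b l} : Finset (Option Q)) = {a l', b l'} →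
      s(a l, b l) = s(a l', b l') := by
    intro l l' h
    have h' : ({a l, b l} : Set (Option Q)) = {a l', b l'} := by
      have := congrArg (fun t : Finset (Option Q) => (t : Set (Option Q))) h
      simpa using this
    rw [Sym2.eq_iff]
    exact Set.pair_eq_pair_iff.1 h'
  obtain ⟨l, hl, l', hl', hne, he⟩ := Finset.exists_ne_map_eq_of_card_lt_of_maps_to hcard
    (f := fun l => {a l, b l}) (by
      intro l hl
      have hl : l ≤ K := by simpa [Nat.lt_succ_iff] using hl
      rw [Finset.mem_coe, Finset.mem_powersetCard]
      refine ⟨?_, Finset.card_pair (hab l hl)⟩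
      intro x hx
      rw [Finset.mem_insert, Finset.mem_singleton] at hx
      rcases hx with rfl | rfl
      · exact Finset.mem_erase.2 ⟨ha l hl, Finset.mem_univ _⟩
      · exact Finset.mem_erase.2 ⟨hb l hl, Finset.mem_univ _⟩)
  rw [Finset.mem_range, Nat.lt_succ_iff] at hl hl'
  rcases lt_or_gt_of_ne hne with h | h
  · exact ⟨l, l', h, hl', key _ _ he⟩
  · exact ⟨l', l, h, hl, key _ _ he.symm⟩

/-- Minimality of `j` keeps the earlier pairs distinct, so that `exists_pair_eq_switch` may change
the family of pairs at `j`. -/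
theorem exists_first_pair_eq {a b : ℕ → Option Q}
    (hab : ∀ l ≤ (Fintype.card Q).choose 2, a l ≠ b l)
    (ha : ∀ l ≤ (Fintype.card Q).choose 2, a l ≠ none)
    (hb : ∀ l ≤ (Fintype.card Q).choose 2, b l ≠ none) :
    ∃ i j, i < j ∧ j ≤ (Fintype.card Q).choose 2 ∧ s(a i, b i) = s(a j, b j) ∧
      ∀ l l', l < l' → l' < j → s(a l, b l) ≠ s(a l', b l') := by
  classical
  obtain ⟨l, l', h1, h2, h3⟩ := exists_pair_eq hab ha hb
  have hex : ∃ j, ∃ i < j, s(a i, b i) = s(a j, b j) := ⟨l', l, h1, h3⟩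
  obtain ⟨i, hi, he⟩ := Nat.find_spec hex
  refine ⟨i, Nat.find hex, hi, (Nat.find_min' hex ⟨l, h1, h3⟩).trans h2, he, ?_⟩
  intro l l' hl hl' h
  exact Nat.find_min hex hl' ⟨l, hl, h⟩

/-- A repetition among the pairs `{a, b}` before `j` and the pairs `{b, c}` from `j` on. -/
theorem exists_pair_eq_switch {a b c : ℕ → Option Q} {j : ℕ}
    (hab : ∀ l ≤ (Fintype.card Q).choose 2, a l ≠ b l)
    (hbc : ∀ l ≤ (Fintype.card Q).choose 2, b l ≠ c l)
    (ha : ∀ l ≤ (Fintype.card Q).choose 2, a l ≠ none)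
    (hb : ∀ l ≤ (Fintype.card Q).choose 2, b l ≠ none)
    (hc : ∀ l ≤ (Fintype.card Q).choose 2, j ≤ l → c l ≠ none)
    (hj : ∀ l l', l < l' → l' < j → s(a l, b l) ≠ s(a l', b l')) :
    ∃ l l', l < l' ∧ l' ≤ (Fintype.card Q).choose 2 ∧ j ≤ l' ∧
      (j ≤ l ∧ s(b l, c l) = s(b l', c l') ∨ s(a l, b l) = s(b l', c l')) := by
  obtain ⟨l, l', h1, h2, h3⟩ := exists_pair_eq
    (a := fun l => if l < j then a l else b l) (b := fun l => if l < j then b l else c l)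
    (fun l hl => by split_ifs; exacts [hab l hl, hbc l hl])
    (fun l hl => by split_ifs; exacts [ha l hl, hb l hl])
    (fun l hl => by split_ifs; exacts [hb l hl, hc l hl (by omega)])
  refine ⟨l, l', h1, h2, ?_⟩
  by_cases hl' : l' < j
  · simp only [hl', h1.trans hl', if_true] at h3
    exact absurd h3 (hj l l' h1 hl')
  · refine ⟨by omega, ?_⟩
    by_cases hl : l < j
    · simp only [hl, hl', if_true, if_false] at h3
      exact Or.inr h3
    · simp only [hl, hl', if_false] at h3
      exact Or.inl ⟨by omega, h3⟩

end Pigeonhole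

/-! ### Actions of words and the effect of testability on strong components. -/

namespace Automaton

variable {α : Type u} {Q : Type v} (A : Automaton α Q)

/-- The action of words on the states and on a sink `none`. -/
def act (x : Option Q) (w : List α) : Option Q := x.bind fun q => A.run q w

@[simp] theorem act_none (w : List α) : A.act none w = none := rfl

@[simp] theorem act_some (q : Q) (w : List α) : A.act (some q) w = A.run q w := rfl

@[simp] theorem act_nil (x : Option Q) : A.act x [] = x := by
  cases x <;> rfl

theorem act_append (x : Option Q) (u v : List α) : A.act x (u ++ v) = A.act (A.act x u) v := by
  cases x with
  | none => rfl
  | some q => exact A.run_append q u v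

/-- Words that are `k`-test equivalent act in the same way on the states. -/
def ActionTestable (k : ℕ) : Prop :=
  1 ≤ k ∧ ∀ u v : List α, u ≠ [] → v ≠ [] → TestEquiv k u v → ∀ p, A.run p u = A.run p v

/-- Reachability in the transition graph, with the sink. -/
def Reach (x y : Option Q) : Prop := ∃ w, A.act x w = y

variable {A}

theorem Reach.trans {x y z : Option Q} (h : A.Reach x y) (h' : A.Reach y z) : A.Reach x z := by
  obtain ⟨u, rfl⟩ := h
  obtain ⟨v, rfl⟩ := h'
  exact ⟨u ++ v, A.act_append _ _ _⟩

theorem reach_act (x : Option Q) (w : List α) : A.Reach x (A.act x w) := ⟨w, rfl⟩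

theorem Reach.ne_none {x y : Option Q} (h : A.Reach x y) (hy : y ≠ none) : x ≠ none := by
  rintro rfl
  obtain ⟨w, rfl⟩ := h
  exact hy rfl

theorem act_wpow_of_fixed {x : Option Q} {g : List α} (h : A.act x g = x) (m : ℕ) :
    A.act x (wpow g m) = x := by
  induction m with
  | zero => simp [wpow]
  | succ m ih => rw [wpow, act_append, h, ih]

namespace ActionTestable

variable {j : ℕ} (H : A.ActionTestable j)

include H

theorem act_eq {u v : List α} (hu : u ≠ []) (hv : v ≠ []) (h : TestEquiv j u v) (x : Option Q) :
    A.act x u = A.act x v := by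
  cases x with
  | none => rfl
  | some q => exact H.2 u v hu hv h q

theorem act_wpow_succ (x : Option Q) (g : List α) :
    A.act x (wpow g (j + 1)) = A.act x (wpow g j) := by
  by_cases hg : g = []
  · have : ∀ m, wpow g m = [] := fun m => by induction m <;> simp_all [wpow]
    rw [this, this]
  · have h1 : ∀ m, 1 ≤ m → wpow g m ≠ [] := fun m hm h => by
      have := le_length_wpow hg m
      simp [h] at this; omega
    exact (H.act_eq (h1 _ H.1) (h1 _ (by omega)) (testEquiv_wpow_succ hg H.1) x).symm

theorem act_wpow_add (x : Option Q) (g : List α) (m : ℕ) :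
    A.act x (wpow g (j + m)) = A.act x (wpow g j) := by
  induction m with
  | zero => rfl
  | succ m ih =>
    rw [← ih, ← Nat.add_assoc, wpow_succ', act_append, ih, ← act_append, ← wpow_succ',
      H.act_wpow_succ]

theorem act_wpow_wpow (x : Option Q) (g : List α) :
    A.act x (wpow g j ++ wpow g j) = A.act x (wpow g j) := by
  have : ∀ m m', wpow g (m + m') = wpow g m ++ wpow g m' := by
    intro m m'
    induction m' with
    | zero => simp [wpow]
    | succ m' ih => rw [← Nat.add_assoc, wpow_succ', ih, List.append_assoc, ← wpow_succ']
  rw [← this, H.act_wpow_add]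

/-- The images of `x` under powers of `g` alternate between `x` and `y`, yet they stabilise. -/
theorem eq_of_swap {x y : Option Q} {g : List α} (h : A.act x g = y) (h' : A.act y g = x) :
    x = y := by
  have key : ∀ m, ∀ x y, A.act x g = y → A.act y g = x →
      A.act x (wpow g (m + 1)) = A.act x (wpow g m) → x = y := by
    intro m
    induction m with
    | zero =>
      intro x y h h' e
      simp only [wpow, List.append_nil, act_nil] at e
      rw [← e, h]
    | succ m ih =>
      intro x y h h' e
      rw [wpow, act_append, h, wpow, act_append (x := x), h] at e
      exact (ih y x h' h e).symm
  exact key j x y h h' (H.act_wpow_succ x g)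

theorem wpow_ne_nil {g : List α} (hg : g ≠ []) : wpow g j ≠ [] := fun h => by
  have := le_length_wpow hg j
  have := H.1
  simp [h] at *; omega

/-- The power `wpow g j` fixes `x` and is long enough to be the overlap in `testEquiv_idem`. -/
theorem act_idem {x : Option Q} {g : List α} (hg : g ≠ []) (hx : A.act x g = x) (u : List α) :
    A.act (A.act x (u ++ wpow g j)) (u ++ wpow g j) = A.act x (u ++ wpow g j) := by
  have h1 := H.act_eq (by simp [H.wpow_ne_nil hg]) (by simp [H.wpow_ne_nil hg])
    (testEquiv_idem ((le_length_wpow hg j).trans (Nat.le_succ _)) u) x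
  rw [act_append, act_append (x := x), act_wpow_of_fixed hx] at h1
  rw [← act_append, ← List.append_assoc, ← h1]

theorem act_comm {x : Option Q} {g : List α} (hg : g ≠ []) (hx : A.act x g = x) (u v : List α) :
    A.act x (u ++ wpow g j ++ v ++ wpow g j) = A.act x (v ++ wpow g j ++ u ++ wpow g j) := by
  have h1 := H.act_eq (by simp [H.wpow_ne_nil hg]) (by simp [H.wpow_ne_nil hg])
    (testEquiv_comm ((le_length_wpow hg j).trans (Nat.le_succ _)) u v) x
  rwa [act_append, act_append (x := x), act_wpow_of_fixed hx] at h1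

/-- Two states of a strongly connected component that have a common loop are equal. -/
theorem eq_of_fixed {x y : Option Q} {g : List α} (hg : g ≠ []) (hx : A.act x g = x)
    (hy : A.act y g = y) (hxy : A.Reach x y) (hyx : A.Reach y x) : x = y := by
  obtain ⟨u, hu⟩ := hxy
  obtain ⟨v, hv⟩ := hyx
  have hxe := act_wpow_of_fixed hx j
  have hye := act_wpow_of_fixed hy j
  have hue : A.act x (u ++ wpow g j) = y := by rw [act_append, hu, hye]
  have hve : A.act y (v ++ wpow g j) = x := by rw [act_append, hv, hxe]
  -- With `e = wpow g j`, idempotence at `x` gives `y·ue = y`. Commutation at `y` then compares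
  -- `y·veue = y` with `y·ueve = x`.
  have h1 := H.act_idem hg hx u
  rw [hue] at h1
  have h2 := H.act_comm hg hy v u
  rw [List.append_assoc, act_append, hve, hue, List.append_assoc, act_append, h1, hve] at h2
  exact h2.symm

end ActionTestable

/-! ### Loops after a word of length `n.choose 2`: the upper bound. -/

theorem exists_take_append {w : List α} {l l' : ℕ} (h : l < l') (h' : l' ≤ w.length) :
    ∃ g h, g ≠ [] ∧ w.take l' = w.take l ++ g ∧ w = w.take l ++ (g ++ h) := by
  have e : w.take l' = w.take l ++ (w.drop l).take (l' - l) := by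
    rw [← List.take_add]; congr 1; omega
  refine ⟨_, w.drop l', ?_, e, ?_⟩
  · intro h0
    have := congrArg List.length h0
    simp at this; omega
  · rw [← List.append_assoc, ← e, List.take_append_drop]

theorem reach_of_wpow {γ : Option Q} {e z h s g h' : List α} (hz : z ≠ [])
    (hγ : ∀ r, A.act γ (wpow z r ++ e) = γ) (hzh : z ++ h = h ++ s) (hh : h = g ++ h') :
    A.Reach (A.act γ g) γ ∧ A.Reach (A.act γ (z ++ g)) γ := by
  obtain ⟨t, ht⟩ := exists_wpow_eq_append hzh hz
  constructor
  · refine ⟨h' ++ t ++ e, ?_⟩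
    have := hγ h.length
    rw [ht, hh] at this
    rw [← act_append]
    simpa using this
  · refine ⟨h' ++ t ++ e, ?_⟩
    have := hγ (h.length + 1)
    rw [wpow, ht, hh] at this
    rw [← act_append]
    simpa using this

/-- The conjugate `z` of `s'`, read after the prefix `w₁`, moves the trajectory of `x` to that of
`x·s'` at the same moment. -/
theorem exists_act_conj {w w₁ h s s' : List α} (e : s' ++ w = w ++ s) (hs' : s' ≠ [])
    (hw : w = w₁ ++ h) : ∃ z, z ++ h = h ++ s ∧ z ≠ [] ∧
      ∀ x, A.act (A.act x w₁) z = A.act (A.act x s') w₁ := by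
  subst hw
  obtain ⟨z, h1, h2, h3⟩ := exists_conj e
  refine ⟨z, h2, ?_, fun x => ?_⟩
  · rintro rfl
    exact hs' (List.length_eq_zero_iff.1 h3.symm)
  · rw [← act_append, ← act_append, h1]

namespace ActionTestable

variable {j : ℕ} (H : A.ActionTestable j)

include H

/-- Distinct trajectories of length `K = n.choose 2` of two states pass through a common loop.
The repetition of pairs is chosen as early as possible. -/
theorem exists_common_loop [Fintype Q] {w : List α}
    (hw : w.length = (Fintype.card Q).choose 2) {x y : Option Q}
    (hne : A.act x w ≠ A.act y w) (hx : A.act x w ≠ none) (hy : A.act y w ≠ none) :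
    ∃ i k g, i < k ∧ k ≤ w.length ∧ g ≠ [] ∧
      A.act (A.act x (w.take i)) g = A.act x (w.take i) ∧
      A.act (A.act y (w.take i)) g = A.act y (w.take i) ∧
      ∀ l l', l < l' → l' < k → s(A.act x (w.take l), A.act y (w.take l)) ≠
        s(A.act x (w.take l'), A.act y (w.take l')) := by
  have hsplit : ∀ l x, A.act x w = A.act (A.act x (w.take l)) (w.drop l) := fun l x => by
    rw [← act_append, List.take_append_drop]
  have hab : ∀ l ≤ (Fintype.card Q).choose 2, A.act x (w.take l) ≠ A.act y (w.take l) :=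
    fun l _ h => hne (by rw [hsplit l, h, ← hsplit l])
  obtain ⟨i, k, h1, h2, h3, h4⟩ := exists_first_pair_eq hab
    (fun l _ h => hx (by rw [hsplit l, h]; rfl)) (fun l _ h => hy (by rw [hsplit l, h]; rfl))
  obtain ⟨g, h, hg, e, -⟩ := exists_take_append (w := w) h1 (by omega)
  refine ⟨i, k, g, h1, by omega, hg, ?_, ?_, h4⟩ <;>
  · rw [e, act_append, act_append, Sym2.eq_iff] at h3
    rcases h3 with ⟨h5, h6⟩ | ⟨h5, h6⟩
    · first | exact h5.symm | exact h6.symm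
    · exact absurd (H.eq_of_swap h6.symm h5.symm) (hab i (by omega))

/-- A loop after a word of length `n.choose 2` acts idempotently. -/
theorem act_loop_idem [Fintype Q] {w s s' : List α} (hw : w.length = (Fintype.card Q).choose 2)
    (e : s' ++ w = w ++ s) (p : Option Q) : A.act p (w ++ s ++ s) = A.act p (w ++ s) := by
  by_contra hne
  have hs' : s' ≠ [] := by
    rintro rfl
    have : s = [] := by simpa using e
    simp [this] at hne
  -- Trajectories of `p`, `p·s'` and `p·s's'` along `w`. If `a` met `b`, or `b` met `c`, at some
  -- moment, idempotence would hold. At this stage only `c` could fall into the sink.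
  set a : ℕ → Option Q := fun l => A.act p (w.take l) with ha
  set b : ℕ → Option Q := fun l => A.act (A.act p s') (w.take l) with hb
  set c : ℕ → Option Q := fun l => A.act (A.act (A.act p s') s') (w.take l) with hc
  have hbw : A.act (A.act p s') w = A.act (A.act p w) s := by
    rw [← act_append, e, act_append]
  have hcw : A.act (A.act (A.act p s') s') w = A.act (A.act (A.act p w) s) s := by
    rw [← act_append, e, act_append, hbw]
  rw [act_append, act_append] at hne
  have hB : A.act (A.act p w) s ≠ none := fun h => hne (by rw [h]; rfl)
  have hA : A.act p w ≠ none := fun h => hB (by rw [h]; rfl)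
  have hABw : A.act p w ≠ A.act (A.act p s') w := fun h => by
    rw [hbw] at h
    exact hne (by rw [← h, ← h])
  have hsplit : ∀ l x, A.act x w = A.act (A.act x (w.take l)) (w.drop l) := fun l x => by
    rw [← act_append, List.take_append_drop]
  have hab : ∀ l ≤ (Fintype.card Q).choose 2, a l ≠ b l :=
    fun l _ h => hABw (by rw [hsplit l p, hsplit l (A.act p s')]; simp only [ha, hb] at h; rw [h])
  have hbc : ∀ l ≤ (Fintype.card Q).choose 2, b l ≠ c l := fun l _ h => hne (by
    rw [← hcw, ← hbw, hsplit l, hsplit l (A.act p s')]; simp only [hc, hb] at h; rw [h])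
  have ha0 : ∀ l ≤ (Fintype.card Q).choose 2, a l ≠ none :=
    fun l _ h => hA (by rw [hsplit l]; simp only [ha] at h; rw [h]; rfl)
  have hb0 : ∀ l ≤ (Fintype.card Q).choose 2, b l ≠ none :=
    fun l _ h => hB (by rw [← hbw, hsplit l]; simp only [hb] at h; rw [h]; rfl)
  obtain ⟨i, k, x, hik, hk, hx, hax, hbx, hmin⟩ := H.exists_common_loop hw hABw hA (hbw ▸ hB)
  -- From time `k` on, `b` and `c` stay in the strong component of `b i`: the conjugate `z` sends `a
  -- i` to `b i`, and idempotence at `a i` shows that every `z ^ r x ^ j` fixes `b i`.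
  have hreach : ∀ l, k ≤ l → l ≤ w.length → (A.Reach (b i) (b l) ∧ A.Reach (b l) (b i)) ∧
      A.Reach (b i) (c l) ∧ A.Reach (c l) (b i) := by
    intro l hl hl'
    obtain ⟨g, h, -, e1, e2⟩ := exists_take_append (w := w) (hik.trans_le hl) hl'
    obtain ⟨z, hz1, hz2, hz3⟩ := exists_act_conj (A := A) e hs' e2
    have hγ : ∀ r, A.act (b i) (wpow z r ++ wpow x j) = b i := by
      intro r
      induction r with
      | zero => exact act_wpow_of_fixed hbx j
      | succ r ih =>
        have h1 : A.act (a i) (wpow z (r + 1) ++ wpow x j) = b i := by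
          rw [wpow, List.append_assoc, act_append, hz3, ih]
        have h2 := H.act_idem hx hax (wpow z (r + 1))
        rwa [h1] at h2
    obtain ⟨h3, h4⟩ := reach_of_wpow (A := A) hz2 hγ hz1 rfl
    have hbl : b l = A.act (b i) g := by simp only [hb, e1, act_append]
    have hcl : c l = A.act (b i) (z ++ g) := by
      simp only [hc, hb, e1]
      rw [act_append, ← hz3, ← act_append]
    rw [hbl, hcl]
    exact ⟨⟨reach_act _ _, h3⟩, reach_act _ _, h4⟩
  obtain ⟨l, l', hll, hl', hkl', hcase⟩ := exists_pair_eq_switch hab hbc ha0 hb0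
    (fun l hl hkl => (hreach l hkl (by omega)).2.2.ne_none (hb0 i (by omega))) hmin
  obtain ⟨⟨r1, r2⟩, r3, r4⟩ := hreach l' hkl' (by omega)
  obtain ⟨g, h, hg, e1, e2⟩ := exists_take_append (w := w) hll (by omega)
  obtain ⟨z, hz1, hz2, hz3⟩ := exists_act_conj (A := A) e hs' e2
  have ea : A.act (a l) g = a l' := by simp only [ha, e1, act_append]
  have eb : A.act (b l) g = b l' := by simp only [hb, e1, act_append]
  have ec : A.act (c l) g = c l' := by simp only [hc, e1, act_append]
  have hl := hll.le.trans hl'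
  rcases hcase with ⟨hkl, hs⟩ | hs
  · obtain ⟨⟨q1, q2⟩, q3, q4⟩ := hreach l hkl (by omega)
    rcases Sym2.eq_iff.1 hs with ⟨h1, h2⟩ | ⟨h1, h2⟩
    · exact hbc l hl (H.eq_of_fixed hg (eb.trans h1.symm) (ec.trans h2.symm) (q2.trans q3)
        (q4.trans q1))
    · exact hbc l hl (H.eq_of_swap (eb.trans h2.symm) (ec.trans h1.symm))
  -- For a repetition between the two families, `z` first shifts `a` to `b` and `b` to `c`, so that
  -- again one word maps a pair onto itself.
  · have ea' : A.act (a l) (z ++ g) = b l' := by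
      rw [act_append]; simp only [ha]; rw [hz3]; exact eb
    have eb' : A.act (b l) (z ++ g) = c l' := by
      rw [act_append]; simp only [hb]; rw [hz3]; exact ec
    rcases Sym2.eq_iff.1 hs with ⟨h1, h2⟩ | ⟨h1, h2⟩
    · refine hab l hl (H.eq_of_fixed (g := z ++ g) (by simp [hz2]) (ea'.trans h1.symm)
        (eb'.trans h2.symm) ?_ ?_)
      · rw [h1, h2]; exact r2.trans r3
      · rw [h1, h2]; exact r4.trans r1
    · exact hab l hl (H.eq_of_swap (ea'.trans h2.symm) (eb'.trans h1.symm))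

theorem act_loop_wpow [Fintype Q] {w s s' : List α}
    (hw : w.length = (Fintype.card Q).choose 2) (e : s' ++ w = w ++ s) (p : Option Q) {m : ℕ}
    (hm : 1 ≤ m) : A.act p (w ++ wpow s m) = A.act p (w ++ s) := by
  induction m, hm using Nat.le_induction with
  | base => simp [wpow]
  | succ m _ ih =>
    rw [wpow_succ', ← List.append_assoc, act_append, ih, ← act_append, H.act_loop_idem hw e]

/-- Commuting `u` with `z ^ r` brings `z ^ r` back to `x`, where it does nothing. -/
theorem act_wpow_append_wpow {x y : Option Q} {g z u : List α} (hg : g ≠ [])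
    (hx : A.act x g = x) (hy : A.act y g = y) (hz : A.act x z = x) (hu : A.act x u = y) (r : ℕ) :
    A.act y (wpow z r ++ wpow g j) = y := by
  have hxe := act_wpow_of_fixed hx j
  have hye := act_wpow_of_fixed hy j
  have h1 := H.act_comm hg hx u (wpow z r)
  simpa only [act_append, hu, hye, act_wpow_of_fixed hz, hxe] using h1

/-- The scheme of `act_loop_idem`, with the trajectories of `p`, `p·t'` and `p·t's'`. -/
theorem act_loop_absorb_of_fixed [Fintype Q] {w s s' t t' : List α}
    (hw : w.length = (Fintype.card Q).choose 2) (e : s' ++ w = w ++ s) (f : t' ++ w = w ++ t)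
    {p : Option Q} (hp : A.act p s' = p) (hss : ∀ x, A.act (A.act x s') s' = A.act x s') :
    A.act p (w ++ t ++ s) = A.act p (w ++ t) := by
  by_contra hne
  have hs' : s' ≠ [] := by
    rintro rfl
    have : s = [] := by simpa using e
    simp [this] at hne
  have hq : A.act (A.act p w) s = A.act p w := by rw [← act_append, ← e, act_append, hp]
  have ht' : t' ≠ [] := by
    rintro rfl
    have : t = [] := by simpa using f
    rw [this, List.append_nil, act_append, hq] at hne
    exact hne rfl
  set a : ℕ → Option Q := fun l => A.act p (w.take l) with ha
  set b : ℕ → Option Q := fun l => A.act (A.act p t') (w.take l) with hb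
  set c : ℕ → Option Q := fun l => A.act (A.act (A.act p t') s') (w.take l) with hc
  have hbw : A.act (A.act p t') w = A.act (A.act p w) t := by
    rw [← act_append, f, act_append]
  have hcw : A.act (A.act (A.act p t') s') w = A.act (A.act (A.act p w) t) s := by
    rw [← act_append, e, act_append, hbw]
  rw [act_append, act_append] at hne
  have hB : A.act (A.act p w) t ≠ none := fun h => hne (by rw [h]; rfl)
  have hA : A.act p w ≠ none := fun h => hB (by rw [h]; rfl)
  have hABw : A.act p w ≠ A.act (A.act p t') w := fun h => by
    rw [hbw] at h
    exact hne (by rw [← h, hq])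
  have hsplit : ∀ l x, A.act x w = A.act (A.act x (w.take l)) (w.drop l) := fun l x => by
    rw [← act_append, List.take_append_drop]
  have hab : ∀ l ≤ (Fintype.card Q).choose 2, a l ≠ b l :=
    fun l _ h => hABw (by rw [hsplit l p, hsplit l (A.act p t')]; simp only [ha, hb] at h; rw [h])
  have hbc : ∀ l ≤ (Fintype.card Q).choose 2, b l ≠ c l := fun l _ h => hne (by
    rw [← hcw, ← hbw, hsplit l, hsplit l (A.act p t')]; simp only [hc, hb] at h; rw [h])
  have ha0 : ∀ l ≤ (Fintype.card Q).choose 2, a l ≠ none :=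
    fun l _ h => hA (by rw [hsplit l]; simp only [ha] at h; rw [h]; rfl)
  have hb0 : ∀ l ≤ (Fintype.card Q).choose 2, b l ≠ none :=
    fun l _ h => hB (by rw [← hbw, hsplit l]; simp only [hb] at h; rw [h]; rfl)
  obtain ⟨i, k, x, hik, hk, hx, hax, hbx, hmin⟩ := H.exists_common_loop hw hABw hA (hbw ▸ hB)
  have hreach : ∀ l, k ≤ l → l ≤ w.length → (A.Reach (b i) (b l) ∧ A.Reach (b l) (b i)) ∧
      A.Reach (b i) (c l) ∧ A.Reach (c l) (b i) := by
    intro l hl hl'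
    obtain ⟨g, h, -, e1, e2⟩ := exists_take_append (w := w) (hik.trans_le hl) hl'
    obtain ⟨z, hz1, hz2, hz3⟩ := exists_act_conj (A := A) e hs' e2
    obtain ⟨y, hy1, hy2, hy3⟩ := exists_act_conj (A := A) f ht' e2
    have haz : A.act (a i) z = a i := by simp only [ha]; rw [hz3, hp]
    have hay : A.act (a i) y = b i := hy3 p
    have hγ : ∀ r, A.act (b i) (wpow z r ++ wpow x j) = b i :=
      H.act_wpow_append_wpow hx hax hbx haz hay
    obtain ⟨h3, h4⟩ := reach_of_wpow (A := A) hz2 hγ hz1 rfl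
    have hbl : b l = A.act (b i) g := by simp only [hb, e1, act_append]
    have hcl : c l = A.act (b i) (z ++ g) := by
      simp only [hc, hb, e1]
      rw [act_append, ← hz3, ← act_append]
    rw [hbl, hcl]
    exact ⟨⟨reach_act _ _, h3⟩, reach_act _ _, h4⟩
  obtain ⟨l, l', hll, hl', hkl', hcase⟩ := exists_pair_eq_switch hab hbc ha0 hb0
    (fun l hl hkl => (hreach l hkl (by omega)).2.2.ne_none (hb0 i (by omega))) hmin
  obtain ⟨⟨r1, r2⟩, r3, r4⟩ := hreach l' hkl' (by omega)
  obtain ⟨g, h, hg, e1, e2⟩ := exists_take_append (w := w) hll (by omega)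
  have ea : A.act (a l) g = a l' := by simp only [ha, e1, act_append]
  have eb : A.act (b l) g = b l' := by simp only [hb, e1, act_append]
  have ec : A.act (c l) g = c l' := by simp only [hc, e1, act_append]
  have hl := hll.le.trans hl'
  rcases hcase with ⟨hkl, hs⟩ | hs
  · obtain ⟨⟨q1, q2⟩, q3, q4⟩ := hreach l hkl (by omega)
    rcases Sym2.eq_iff.1 hs with ⟨h1, h2⟩ | ⟨h1, h2⟩
    · exact hbc l hl (H.eq_of_fixed hg (eb.trans h1.symm) (ec.trans h2.symm) (q2.trans q3)
        (q4.trans q1))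
    · exact hbc l hl (H.eq_of_swap (eb.trans h2.symm) (ec.trans h1.symm))
  -- The conjugate `z` of `s'` fixes both `a l'` and `c l'`. The repetition puts them into one
  -- strong component, so they coincide, and `g` then swaps or fixes `a l` and `b l`.
  · have hw' : w = w.take l' ++ w.drop l' := (List.take_append_drop _ _).symm
    obtain ⟨z, -, hz2, hz3⟩ := exists_act_conj (A := A) e hs' hw'
    obtain ⟨y, -, -, hy3⟩ := exists_act_conj (A := A) f ht' hw'
    have haz : A.act (a l') z = a l' := by simp only [ha]; rw [hz3, hp]
    have hcz : A.act (c l') z = c l' := by simp only [hc]; rw [hz3, hss]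
    have hay : A.Reach (a l') (b l') := ⟨y, hy3 p⟩
    have hal : A.Reach (a l) (a l') := ⟨g, ea⟩
    have r5 : A.Reach (b l') (c l') := r2.trans r3
    have r6 : A.Reach (c l') (b l') := r4.trans r1
    rcases Sym2.eq_iff.1 hs with ⟨h1, h2⟩ | ⟨h1, h2⟩
    · have h3 : a l' = c l' := H.eq_of_fixed hz2 haz hcz (hay.trans r5) (r6.trans (h1 ▸ hal))
      exact hab l hl (H.eq_of_swap (ea.trans (h3.trans h2.symm)) (eb.trans h1.symm))
    · have h3 : a l' = c l' := H.eq_of_fixed hz2 haz hcz (hay.trans r5) (h1 ▸ hal)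
      exact hab l hl (H.eq_of_fixed hg (ea.trans (h3.trans h1.symm)) (eb.trans h2.symm)
        (by rw [h1, h2]; exact r6) (by rw [h1, h2]; exact r5))

/-- Replacing `s'` by its `j`-th power makes its action idempotent and fixes the new starting state
`p·s'^j`. -/
theorem act_loop_absorb [Fintype Q] {w s s' t t' : List α}
    (hw : w.length = (Fintype.card Q).choose 2) (e : s' ++ w = w ++ s) (f : t' ++ w = w ++ t)
    {p : Option Q} (hp : A.act p (w ++ s) = A.act p w) :
    A.act p (w ++ t ++ s) = A.act p (w ++ t) := by
  have hj := H.1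
  have ej := wpow_conj e j
  have h0 : A.act (A.act p (wpow s' j)) w = A.act p w := by
    rw [← act_append, ej, H.act_loop_wpow hw e p hj, hp]
  have h1 := H.act_loop_absorb_of_fixed (p := A.act p (wpow s' j)) hw ej f
    (by rw [← act_append, H.act_wpow_wpow])
    (fun x => by rw [← act_append, H.act_wpow_wpow])
  simp only [act_append, h0] at h1
  have h2 := H.act_loop_wpow hw e (A.act p t') hj
  rw [act_append, act_append, ← act_append A p, f, act_append] at h2
  rw [act_append, act_append, ← h2, h1]

/-- Unless `p·w = d`, the trajectories of `p` and `P = p·(s't')^j` share a loop at some moment, at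
states `a` and `D`. A word through `t ++ s` returns `D` to itself; by commutation at `a` it may be
read before the passage from `a` to `D`. Read from `a`, it passes through `p·wts`, and the path
continues to `D` and then to `d`. -/
theorem reach_of_loops [Fintype Q] {w s s' t t' : List α}
    (hw : w.length = (Fintype.card Q).choose 2) (e : s' ++ w = w ++ s) (f : t' ++ w = w ++ t)
    {p d : Option Q} (hd : A.act p (w ++ s ++ t) = d) (hd0 : d ≠ none) (hds : A.act d s = d)
    (hdt : A.act d t = d) : A.Reach (A.act p (w ++ t ++ s)) d := by
  by_cases hq : A.act p w = d
  · refine ⟨[], ?_⟩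
    rw [act_nil, act_append, act_append, hq, hdt, hds]
  have ef : (s' ++ t') ++ w = w ++ (s ++ t) := by
    rw [List.append_assoc, f, ← List.append_assoc, e, List.append_assoc]
  have fe : (t' ++ s') ++ w = w ++ (t ++ s) := by
    rw [List.append_assoc, e, ← List.append_assoc, f, List.append_assoc]
  have efj := wpow_conj ef j
  set P := A.act p (wpow (s' ++ t') j) with hP
  have hPw : A.act P w = d := by
    rw [hP, ← act_append, efj, H.act_loop_wpow hw ef p H.1, ← List.append_assoc, hd]
  have hP2 : A.act P (wpow (s' ++ t') j) = P := by
    rw [hP, ← act_append, H.act_wpow_wpow]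
  obtain ⟨i, k, x, -, -, hx, hax, hdx, -⟩ := H.exists_common_loop hw (x := p) (y := P)
    (by rw [hPw]; exact hq)
    (fun h => hd0 (by rw [← hd, act_append, act_append, h]; rfl)) (by rwa [hPw])
  have hst : s' ++ t' ≠ [] := by
    intro h
    have h1 := ef
    rw [h, List.nil_append, List.self_eq_append_right, List.append_eq_nil_iff] at h1
    rw [h1.1, h1.2, List.append_nil, List.append_nil] at hd
    exact hq hd
  have hts : t' ++ s' ≠ [] := by
    simp only [ne_eq, List.append_eq_nil_iff] at hst ⊢
    tauto
  have hw' : w = w.take i ++ w.drop i := (List.take_append_drop _ _).symm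
  obtain ⟨z, hz1, hz2, hz3⟩ := exists_act_conj (A := A) efj (H.wpow_ne_nil hst) hw'
  obtain ⟨y, hy1, -, -⟩ := exists_act_conj (A := A) fe hts hw'
  obtain ⟨u, hu⟩ := exists_wpow_eq_append hz1 hz2
  have hsplit : ∀ x, A.act (A.act x (w.take i)) (w.drop i) = A.act x w := fun x => by
    rw [← act_append, ← hw']
  have hpw : A.act (A.act p (w.take i)) (y ++ w.drop i) = A.act p (w ++ t ++ s) := by
    rw [hy1, act_append, hsplit, ← act_append, List.append_assoc]
  have haz : A.act (A.act p (w.take i)) z = A.act P (w.take i) := hz3 p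
  have hdz : A.act (A.act P (w.take i)) z = A.act P (w.take i) := by rw [hz3, hP2]
  have hdd : A.act (A.act P (w.take i)) (w.drop i) = d := by rw [hsplit, hPw]
  have hdu : A.act d u = A.act P (w.take i) := by
    rw [← hdd, ← act_append, ← hu, act_wpow_of_fixed hdz]
  have hdy : A.act (A.act P (w.take i)) (y ++ w.drop i ++ u) = A.act P (w.take i) := by
    rw [hy1, act_append, act_append, hdd, act_append, hdt, hds, hdu]
  generalize A.act P (w.take i) = D at *
  generalize A.act p (w.take i) = a at *
  have hDe : A.act D (wpow x j) = D := act_wpow_of_fixed hdx j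
  have h1 := H.act_comm hx hax z (y ++ w.drop i ++ u)
  have h2 : A.act a (z ++ wpow x j ++ (y ++ w.drop i ++ u) ++ wpow x j) = D := by
    rw [act_append, act_append (u := z ++ wpow x j), act_append (u := z), haz, hDe, hdy, hDe]
  refine Reach.trans (y := D) ⟨u ++ wpow x j ++ z ++ wpow x j, ?_⟩ ⟨w.drop i, hdd⟩
  rw [← hpw, ← act_append, ← h2, h1]
  simp only [List.append_assoc]

/-- Loops after a word of length `n.choose 2` commute. -/
theorem act_loop_comm [Fintype Q] {w s s' t t' : List α}
    (hw : w.length = (Fintype.card Q).choose 2) (e : s' ++ w = w ++ s) (f : t' ++ w = w ++ t)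
    (p : Option Q) : A.act p (w ++ s ++ t) = A.act p (w ++ t ++ s) := by
  by_cases hs : s = []
  · simp [hs]
  -- Absorption and idempotence make both results fixed points of `s` and `t`; when they also reach
  -- each other, `eq_of_fixed` applies.
  have key : ∀ s s' t t' : List α, s' ++ w = w ++ s → t' ++ w = w ++ t →
      A.act (A.act p (w ++ s ++ t)) s = A.act p (w ++ s ++ t) ∧
        A.act (A.act p (w ++ s ++ t)) t = A.act p (w ++ s ++ t) := by
    intro s s' t t' e f
    have h1 : ∀ u, A.act p (w ++ s ++ u) = A.act (A.act p s') (w ++ u) := fun u => by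
      rw [← e, List.append_assoc, act_append]
    constructor
    · have := H.act_loop_absorb hw e f (p := A.act p s') (by
        rw [← h1, H.act_loop_idem hw e, ← e, act_append])
      rwa [act_append, ← h1] at this
    · have := H.act_loop_idem hw f (A.act p s')
      rwa [act_append, ← h1] at this
  obtain ⟨d1, d2⟩ := key s s' t t' e f
  obtain ⟨d3, d4⟩ := key t t' s s' f e
  have r1 := fun h => H.reach_of_loops hw e f rfl h d1 d2
  have r2 := fun h => H.reach_of_loops hw f e rfl h d3 d4
  by_cases h1 : A.act p (w ++ s ++ t) = none
  · by_cases h2 : A.act p (w ++ t ++ s) = none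
    · rw [h1, h2]
    · exact absurd h1 ((r2 h2).ne_none h2)
  · have r := r1 h1
    exact H.eq_of_fixed hs d1 d4 (r2 (r.ne_none h1)) r

theorem loopInvariant [Fintype Q] (p : Option Q) :
    LoopInvariant ((Fintype.card Q).choose 2) (A.act p) where
  cong h g := by rw [act_append, h, act_append]
  idem := by
    rintro w v g hv ⟨w, rfl⟩ ⟨g', hg⟩
    have := H.act_loop_idem hv hg (A.act p w)
    rwa [← act_append, ← act_append, ← List.append_assoc, ← List.append_assoc] at this
  comm := by
    rintro w v g h hv ⟨w, rfl⟩ ⟨g', hg⟩ ⟨h', hh⟩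
    have := H.act_loop_comm hv hg hh (A.act p w)
    rwa [← act_append, ← act_append, ← List.append_assoc, ← List.append_assoc,
      ← List.append_assoc, ← List.append_assoc] at this

/-- The upper bound on the order of local testability. -/
theorem actionTestable_choose_two [Fintype Q] :
    A.ActionTestable ((Fintype.card Q).choose 2 + 1) :=
  ⟨by omega, fun _ _ _ _ h p => (H.loopInvariant (some p)).eq_of_testEquiv h⟩

end ActionTestable

end Automaton

/-! ### Substitutions and independence of the generators. -/

section Substitution

variable {α : Type u} {β : Type u}

theorem length_le_flatMap {f : α → List β} (hf : ∀ a, f a ≠ []) (w : List α) :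
    w.length ≤ (w.flatMap f).length := by
  induction w with
  | nil => simp
  | cons a w ih =>
    have := List.length_pos_of_ne_nil (hf a)
    simp only [List.length_cons, List.flatMap_cons, List.length_append]; omega

theorem flatMap_infix {f : α → List β} {w w' : List α} (h : w <:+: w') :
    w.flatMap f <:+: w'.flatMap f := by
  obtain ⟨s, t, rfl⟩ := h
  exact ⟨s.flatMap f, t.flatMap f, by simp⟩

/-- Images of letters are nonempty, so a window of length `k` meets at most `k` consecutive images.
-/
theorem exists_factor_of_mem_flatMap {f : α → List β} (hf : ∀ a, f a ≠ []) {k : ℕ} (hk : 1 ≤ k)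
    {w : List α} (hw : k ≤ w.length) {x : List β} (hx : x ∈ factors k (w.flatMap f)) :
    ∃ y ∈ factors k w, x <:+: y.flatMap f := by
  induction w with
  | nil => simp at hw; omega
  | cons a w ih =>
    by_cases hl : k ≤ w.length
    · have hlen : k ≤ ((w.take (k - 1)).flatMap f).length + 1 := by
        have := length_le_flatMap hf (w.take (k - 1))
        simp only [List.length_take] at this; omega
      have e : (a :: w).flatMap f =
          f a ++ (w.take (k - 1)).flatMap f ++ (w.drop (k - 1)).flatMap f := by
        rw [List.append_assoc, ← List.flatMap_append, List.take_append_drop, List.flatMap_cons]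
      rw [e, factors_overlap _ _ hlen, ← List.flatMap_append, List.take_append_drop] at hx
      rcases hx with hx | hx
      · refine ⟨a :: w.take (k - 1), ⟨by simp; omega, ?_⟩, by simpa using hx.2⟩
        exact ⟨[], w.drop (k - 1), by simp⟩
      · obtain ⟨y, hy, hxy⟩ := ih hl hx
        exact ⟨y, factors_mono (List.suffix_cons _ _).isInfix hy, hxy⟩
    · exact ⟨a :: w, ⟨by simp at hw ⊢; omega, List.infix_refl _⟩, hx.2⟩

/-- Substitutions of nonempty words preserve `TestEquiv`. -/
theorem TestEquiv.flatMap {f : α → List β} (hf : ∀ a, f a ≠ []) {k : ℕ} (hk : 1 ≤ k)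
    {p q : List α} (h : TestEquiv k p q) : TestEquiv k (p.flatMap f) (q.flatMap f) := by
  rcases h.eq_or hk with rfl | ⟨hp, hq⟩
  · exact ⟨rfl, rfl, rfl⟩
  have hlen : ∀ w : List α, k - 1 ≤ w.length → k - 1 ≤ (w.flatMap f).length := fun w hw =>
    hw.trans (length_le_flatMap hf w)
  obtain ⟨h1, h2, h3⟩ := h
  have key : ∀ p q : List α, k ≤ p.length → factors k p = factors k q →
      factors k (p.flatMap f) ⊆ factors k (q.flatMap f) := by
    intro p q hp h x hx
    obtain ⟨y, hy, hxy⟩ := exists_factor_of_mem_flatMap hf hk hp hx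
    rw [h] at hy
    exact ⟨hx.1, hxy.trans (flatMap_infix hy.2)⟩
  have htake : ∀ p : List α, k ≤ p.length →
      (p.flatMap f).take (k - 1) = ((p.take (k - 1)).flatMap f).take (k - 1) := by
    intro p hp
    conv_lhs => rw [← List.take_append_drop (k - 1) p, List.flatMap_append]
    exact take_append_eq _ (hlen _ (by simp; omega))
  have hrtake : ∀ p : List α, k ≤ p.length →
      (p.flatMap f).rtake (k - 1) = ((p.rtake (k - 1)).flatMap f).rtake (k - 1) := by
    intro p hp
    obtain ⟨t, ht⟩ := rtake_suffix (k - 1) p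
    conv_lhs => rw [← ht, List.flatMap_append]
    exact rtake_append_eq _ (hlen _ (length_rtake (by omega)).ge)
  exact ⟨by rw [htake p hp, htake q hq, h1], by rw [hrtake p hp, hrtake q hq, h2],
    (key p q hp h3).antisymm (key q p hq h3.symm)⟩

theorem letters_lift (σ : α → FreeSemigroup β) (w : FreeSemigroup α) :
    letters (FreeSemigroup.lift σ w) = (letters w).flatMap fun a => letters (σ a) := by
  induction w using FreeSemigroup.recOnMul with
  | ih1 a => simp [letters]
  | ih2 a w ih1 ih2 =>
    have key : ∀ {γ : Type u} (x y : FreeSemigroup γ), letters (x * y) = letters x ++ letters y :=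
      fun _ _ => rfl
    rw [map_mul, key, key, ih1, ih2, List.flatMap_append]

end Substitution

/-! ### From semigroups and languages to actions. -/

namespace Automaton

variable {α : Type u} {Q : Type v} (A : Automaton α Q)

/-- Each letter of `α` is represented by a word over `Δ`, and this substitution carries test
equivalence from `α` to `Δ`. -/
theorem testable_iff {k : ℕ} : A.Testable k ↔ A.ActionTestable k := by
  let π : FreeSemigroup α →ₙ* A.TransitionSemigroup :=
    ⟨fun w => (w : A.transitionCon.Quotient), fun _ _ => rfl⟩
  have hπ : ∀ u v, π u = π v ↔ ∀ p, A.run p (letters u) = A.run p (letters v) :=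
    fun u v => Con.eq _
  constructor
  · rintro ⟨hk, Δ, φ, hφ, h⟩
    refine ⟨hk, fun u v hu hv huv p => ?_⟩
    choose σ hσ using fun a : α => hφ (π (FreeSemigroup.of a))
    have hlift : ∀ w, φ (FreeSemigroup.lift σ w) = π w := by
      intro w
      have : φ.comp (FreeSemigroup.lift σ) = π := by
        apply FreeSemigroup.hom_ext
        funext a
        simp [hσ]
      exact DFunLike.congr_fun this w
    have key : ∀ u v : FreeSemigroup α, TestEquiv k (letters u) (letters v) → π u = π v := by
      intro u v huv
      rw [← hlift, ← hlift]
      apply h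
      rw [letters_lift, letters_lift]
      exact huv.flatMap (fun _ => List.cons_ne_nil _ _) hk
    obtain ⟨a, u, rfl⟩ := List.exists_cons_of_ne_nil hu
    obtain ⟨b, v, rfl⟩ := List.exists_cons_of_ne_nil hv
    exact (hπ ⟨a, u⟩ ⟨b, v⟩).1 (key _ _ huv) p
  · rintro ⟨hk, h⟩
    refine ⟨hk, α, π, fun x => Con.induction_on x fun w => ⟨w, rfl⟩, fun u v huv => ?_⟩
    exact (hπ u v).2 (h _ _ (List.cons_ne_nil _ _) (List.cons_ne_nil _ _) huv)

open Classical in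
/-- The transitions into the states from which nothing is accepted are removed. -/
noncomputable def trim : Automaton α Q where
  step p a := (A.step p a).filter fun q => (A.acceptsFrom q).Nonempty
  start := A.start
  accept := A.accept

/-- If the last state of a run is live, so are all those before it. -/
theorem trim_run_eq_some {p q : Q} {w : List α} (hw : w ≠ []) :
    A.trim.run p w = some q ↔ A.run p w = some q ∧ (A.acceptsFrom q).Nonempty := by
  have hstep : ∀ p q a, A.trim.step p a = some q ↔
      A.step p a = some q ∧ (A.acceptsFrom q).Nonempty := by
    intro p q a
    simp [trim, Option.filter_eq_some_iff]
  induction w generalizing p with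
  | nil => exact absurd rfl hw
  | cons a w ih =>
    simp only [run, Option.bind_eq_some_iff, hstep]
    by_cases h : w = []
    · subst h
      simp only [run, Option.some.injEq]
      constructor
      · rintro ⟨r, h, rfl⟩
        exact ⟨⟨r, h.1, rfl⟩, h.2⟩
      · rintro ⟨⟨r, h, rfl⟩, h'⟩
        exact ⟨r, ⟨h, h'⟩, rfl⟩
    · constructor
      · rintro ⟨r, ⟨h1, -⟩, h2⟩
        have h2 := (ih h).1 h2
        exact ⟨⟨r, h1, h2.1⟩, h2.2⟩
      · rintro ⟨⟨r, h1, h2⟩, h3⟩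
        refine ⟨r, ⟨h1, ?_⟩, (ih h).2 ⟨h2, h3⟩⟩
        obtain ⟨y, s, hs, hy⟩ := h3
        exact ⟨w ++ y, s, hs, by rw [run_append, h2]; exact hy⟩

variable {A}

theorem mem_acceptsFrom_of_run {p q : Q} {w y : List α} (h : A.run p w = some q) :
    w ++ y ∈ A.acceptsFrom p ↔ y ∈ A.acceptsFrom q := by
  change (∃ r ∈ A.accept, A.run p (w ++ y) = some r) ↔ ∃ r ∈ A.accept, A.run q y = some r
  rw [run_append, h]
  rfl

/-- Surrounding `u` and `v` by a word that reaches `p` and by any continuation compares what is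
accepted after them, which determines the end state. The language cannot tell a dead state from an
undefined transition, hence `trim`. -/
theorem IsReduced.acceptsTestable_iff (hA : A.IsReduced) {k : ℕ} :
    A.AcceptsTestable k ↔ A.trim.ActionTestable k := by
  constructor
  · rintro ⟨hk, h⟩
    refine ⟨hk, fun u v hu hv huv p => ?_⟩
    obtain ⟨x, hx⟩ := hA.1 p
    have key : ∀ u v : List α, u ≠ [] → v ≠ [] → TestEquiv k u v → ∀ q,
        A.trim.run p u = some q → A.trim.run p v = some q := by
      intro u v hu hv huv q hq
      rw [trim_run_eq_some A hu] at hq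
      rw [trim_run_eq_some A hv]
      obtain ⟨hq, y₀, hy₀⟩ := hq
      have hacc : ∀ y, u ++ y ∈ A.acceptsFrom p ↔ v ++ y ∈ A.acceptsFrom p := by
        intro y
        have := h (x ++ u ++ y) (x ++ v ++ y) (by simp [hu]) (by simp [hv]) (huv.append hk x y)
        rw [language, List.append_assoc, List.append_assoc, mem_acceptsFrom_of_run hx,
          mem_acceptsFrom_of_run hx] at this
        exact this
      obtain ⟨r, hr⟩ : ∃ r, A.run p v = some r := by
        obtain ⟨s, -, hs⟩ := (hacc y₀).1 ((mem_acceptsFrom_of_run hq).2 hy₀)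
        rw [run_append, Option.bind_eq_some_iff] at hs
        exact ⟨hs.choose, hs.choose_spec.1⟩
      have : q = r := by
        apply hA.2
        ext y
        rw [← mem_acceptsFrom_of_run hq, hacc, mem_acceptsFrom_of_run hr]
      exact ⟨this ▸ hr, y₀, hy₀⟩
    exact Option.ext fun q => ⟨key u v hu hv huv q, key v u hv hu huv.symm q⟩
  · rintro ⟨hk, h⟩
    refine ⟨hk, ?_⟩
    have key : ∀ u v : List α, u ≠ [] → v ≠ [] → TestEquiv k u v →
        u ∈ A.language → v ∈ A.language := by
      rintro u v hu hv huv ⟨q, hq, hr⟩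
      have h1 : A.trim.run A.start u = some q :=
        (trim_run_eq_some A hu).2 ⟨hr, [], q, hq, rfl⟩
      rw [h u v hu hv huv, trim_run_eq_some A hv] at h1
      exact ⟨q, hq, h1.1⟩
    exact fun u v hu hv huv => ⟨key u v hu hv huv, key v u hv hu huv.symm⟩

theorem trim_eq_self (h : ∀ q, (A.acceptsFrom q).Nonempty) : A.trim = A := by
  have : A.trim.step = A.step := by
    funext p a
    cases hs : A.step p a <;> simp [trim, hs, h]
  cases A
  simp only [trim, mk.injEq] at this ⊢
  exact ⟨this, trivial, trivial⟩

theorem PreciselyTestable.le_choose_two [Fintype Q] {k : ℕ} (h : A.PreciselyTestable k) :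
    k ≤ (Fintype.card Q).choose 2 + 1 :=
  h.2 (A.testable_iff.2 ((A.testable_iff.1 h.1).actionTestable_choose_two))

/-- Trimming keeps the set of states, so the bound is unaffected. -/
theorem AcceptsPreciselyTestable.le_choose_two [Fintype Q] (hA : A.IsReduced) {k : ℕ}
    (h : A.AcceptsPreciselyTestable k) : k ≤ (Fintype.card Q).choose 2 + 1 :=
  h.2 (hA.acceptsTestable_iff.2 ((hA.acceptsTestable_iff.1 h.1).actionTestable_choose_two))

end Automaton

/-! ### The automaton `M`. -/

open Automaton

instance finite_letter (n : ℕ) : Finite (Letter n) := by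
  let f : Letter n → Option (Fin n × Fin n) := fun x => match x with
    | .a => none
    | .b i j _ _ => some (i, j)
  refine Finite.of_injective f ?_
  rintro (_ | _) (_ | _) h <;> simp_all [f]

variable {n : ℕ} {s : Fin n} {F : Set (Fin n)}

theorem M_step_a {k : Fin n} (hk : k.val = 2) : (M n s F).step k .a = some ⟨0, k.pos⟩ := by
  simp [M, stepM, hk]

theorem M_step_b_left {i j : Fin n} (hi : i.val + 2 < n) (hij : i < j) (hj : j.val + 1 < n) :
    (M n s F).step i (.b i j hi hij) = some i := by
  simp [M, stepM, hj]

theorem M_step_b_right {i j : Fin n} (hi : i.val + 2 < n) (hij : i < j) (hj : j.val + 1 < n) :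
    (M n s F).step j (.b i j hi hij) = some ⟨j.val + 1, hj⟩ := by
  simp [M, stepM, hj, hij.ne']

theorem M_step_b_left_last {i j : Fin n} (hi : i.val + 2 < n) (hij : i < j)
    (hj : ¬ j.val + 1 < n) :
    (M n s F).step i (.b i j hi hij) = some ⟨i.val + 1, by omega⟩ := by
  simp [M, stepM, hj]

theorem M_step_b_right_last {i j : Fin n} (hi : i.val + 2 < n) (hij : i < j)
    (hj : ¬ j.val + 1 < n) :
    (M n s F).step j (.b i j hi hij) = some ⟨i.val + 2, hi⟩ := by
  simp [M, stepM, hj, hij.ne']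

theorem M_step_b_eq_none {i j k : Fin n} (hi : i.val + 2 < n) (hij : i < j) (h1 : k ≠ i)
    (h2 : k ≠ j) : (M n s F).step k (.b i j hi hij) = none := by
  simp [M, stepM, h1, h2]

/-- The number of pairs of states that are not lexicographically less than `(i, j)`. -/
def remaining (n i j : ℕ) : ℕ := (n - j) + (n - 1 - i).choose 2

theorem remaining_succ {i j : ℕ} (hj : j < n) : remaining n i j = remaining n i (j + 1) + 1 := by
  unfold remaining; omega

theorem remaining_last {i : ℕ} (hi : i + 2 < n) :
    remaining n i (n - 1) = remaining n (i + 1) (i + 2) + 1 := by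
  obtain ⟨m, rfl⟩ : ∃ m, n = i + 3 + m := ⟨n - (i + 3), by omega⟩
  unfold remaining
  have e1 : i + 3 + m - 1 - i = m + 2 := by omega
  have e2 : i + 3 + m - 1 - (i + 1) = m + 1 := by omega
  have e3 : i + 3 + m - (i + 2) = m + 1 := by omega
  rw [e1, e2, e3, Nat.choose_succ_succ' (m + 1) 1, Nat.choose_one_right, one_add_one_eq_two]
  omega

theorem remaining_zero_one (hn : 2 < n) : remaining n 0 1 = n.choose 2 := by
  obtain ⟨m, rfl⟩ : ∃ m, n = m + 1 := ⟨n - 1, by omega⟩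
  simp [remaining, Nat.choose_succ_succ' m 1]

/-- A letter that is defined on two states increases their pair. -/
theorem M_step_pair {p q p' q' : Fin n} (hpq : p < q) {x : Letter n}
    (hp : (M n s F).step p x = some p') (hq : (M n s F).step q x = some q') :
    p' < q' ∧ remaining n p q = remaining n p' q' + 1 := by
  cases x with
  | a =>
    exfalso
    simp only [M, stepM, Option.ite_none_right_eq_some] at hp hq
    exact hpq.ne (Fin.ext (hp.1.trans hq.1.symm))
  | b i j hi hij =>
    have key : ∀ k k' : Fin n, (M n s F).step k (.b i j hi hij) = some k' → k = i ∨ k = j := by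
      intro k k' h
      by_contra hk
      rw [not_or] at hk
      rw [M_step_b_eq_none hi hij hk.1 hk.2] at h
      exact Option.some_ne_none _ h.symm
    obtain ⟨rfl, rfl⟩ : p = i ∧ q = j := by
      rcases key _ _ hp with rfl | rfl <;> rcases key _ _ hq with rfl | rfl
      · exact (lt_irrefl _ hpq).elim
      · exact ⟨rfl, rfl⟩
      · exact (lt_asymm hpq hij).elim
      · exact (lt_irrefl _ hpq).elim
    by_cases hj : q.val + 1 < n
    · rw [M_step_b_left hi hij hj, Option.some.injEq] at hp
      rw [M_step_b_right hi hij hj, Option.some.injEq] at hq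
      subst hp hq
      exact ⟨Fin.lt_def.2 (Nat.lt_succ_of_lt hpq), remaining_succ q.2⟩
    · rw [M_step_b_left_last hi hij hj, Option.some.injEq] at hp
      rw [M_step_b_right_last hi hij hj, Option.some.injEq] at hq
      subst hp hq
      have hq : q.val = n - 1 := by have := q.2; omega
      exact ⟨Fin.lt_def.2 (Nat.lt_succ_self _), by rw [hq]; exact remaining_last hi⟩

theorem M_run_pair {p q p' q' : Fin n} (hpq : p < q) {w : List (Letter n)}
    (hp : (M n s F).run p w = some p') (hq : (M n s F).run q w = some q') :
    p' < q' ∧ remaining n p q = remaining n p' q' + w.length := by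
  induction w generalizing p q with
  | nil =>
    simp only [run, Option.some.injEq] at hp hq
    subst hp hq
    exact ⟨hpq, rfl⟩
  | cons x w ih =>
    simp only [run, Option.bind_eq_some_iff] at hp hq
    obtain ⟨p₁, hp₁, hp⟩ := hp
    obtain ⟨q₁, hq₁, hq⟩ := hq
    obtain ⟨h1, h2⟩ := M_step_pair hpq hp₁ hq₁
    obtain ⟨h3, h4⟩ := ih h1 hp hq
    exact ⟨h3, by rw [h2, h4, List.length_cons]; omega⟩

theorem remaining_le {i j : ℕ} (hij : i < j) (hj : j < n) : remaining n i j ≤ n.choose 2 := by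
  have h1 : (n - i).choose 2 = (n - 1 - i) + (n - 1 - i).choose 2 := by
    obtain ⟨m, hm⟩ : ∃ m, n - i = m + 1 := ⟨n - i - 1, by omega⟩
    have : n - 1 - i = m := by omega
    rw [hm, this, Nat.choose_succ_succ' m 1, Nat.choose_one_right]
  have h2 : (n - i).choose 2 ≤ n.choose 2 := Nat.choose_le_choose 2 (by omega)
  unfold remaining; omega

/-- For distinct states, `remaining` would drop by `n.choose 2` from at most that value and still be
positive. -/
theorem M_run_eq {w : List (Letter n)} (hw : w.length = n.choose 2) {p q p' q' : Fin n}
    (hp : (M n s F).run p w = some p') (hq : (M n s F).run q w = some q') : p = q := by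
  have key : ∀ {p q p' q' : Fin n}, p < q → (M n s F).run p w = some p' →
      (M n s F).run q w = some q' → False := by
    intro p q p' q' hpq hp hq
    have h1 := (M_run_pair hpq hp hq).2
    have h2 := remaining_le hpq q.2
    have h3 : 0 < remaining n p' q' := by
      have := q'.2
      unfold remaining; omega
    omega
  rcases lt_trichotomy p q with h | h | h
  · exact (key h hp hq).elim
  · exact h
  · exact (key h hq hp).elim

/-- If `w` is defined on both `p` and `p·g'`, these states are equal, so `p·wg = p·g'w = p·w`. -/
theorem M_act_eq_or {w : List (Letter n)} (hw : w.length = n.choose 2) {g g' : List (Letter n)}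
    (e : g' ++ w = w ++ g) (p : Option (Fin n)) :
    (M n s F).act p (w ++ g) = none ∨ (M n s F).act p (w ++ g) = (M n s F).act p w := by
  cases h : (M n s F).act p (w ++ g) with
  | none => exact Or.inl rfl
  | some r =>
    right
    have h1 : (M n s F).act ((M n s F).act p w) g = some r := by rw [← act_append, h]
    have h2 : (M n s F).act ((M n s F).act p g') w = some r := by rw [← act_append, e, h]
    cases p with
    | none => simp at h1
    | some p =>
      cases hp : (M n s F).act (some p) g' with
      | none => rw [hp] at h2; simp at h2
      | some p' =>
        cases hq : (M n s F).act (some p) w with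
        | none => rw [hq] at h1; simp at h1
        | some q =>
          rw [hp] at h2
          rw [act_some] at h2 hq
          obtain rfl := M_run_eq hw hq h2
          rw [← h2, hq]

theorem M_loopInvariant (p : Option (Fin n)) : LoopInvariant (n.choose 2) ((M n s F).act p) where
  cong h g := by rw [act_append, h, act_append]
  idem := by
    rintro w v g hv ⟨w, rfl⟩ ⟨g', hg⟩
    have h := M_act_eq_or (s := s) (F := F) hv hg ((M n s F).act p w)
    simp only [act_append] at h ⊢
    rcases h with h | h <;> simp [h]
  comm := by
    rintro w v g h hv ⟨w, rfl⟩ ⟨g', hg⟩ ⟨h', hh⟩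
    have h1 := M_act_eq_or (s := s) (F := F) hv hg ((M n s F).act p w)
    have h2 := M_act_eq_or (s := s) (F := F) hv hh ((M n s F).act p w)
    simp only [act_append] at h1 h2 ⊢
    rcases h1 with h1 | h1 <;> rcases h2 with h2 | h2 <;> simp [h1, h2]

theorem M_actionTestable : (M n s F).ActionTestable (n.choose 2 + 1) :=
  ⟨by omega, fun _ _ _ _ h p => (M_loopInvariant (some p)).eq_of_testEquiv h⟩

/-- The longest chain of pairs of states. -/
theorem M_exists_chain (hn : 2 < n) (r : ℕ) {i j : Fin n} (hij : i < j)
    (hr : remaining n i j = r + 1) : ∃ w : List (Letter n), w.length = r ∧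
      (M n s F).run i w = some ⟨n - 2, by omega⟩ ∧ (M n s F).run j w = some ⟨n - 1, by omega⟩ := by
  induction r generalizing i j with
  | zero =>
    have h1 := j.2
    have h2 : i.val < j.val := hij
    unfold remaining at hr
    have h3 : (n - 1 - i.val).choose 2 = 0 := by omega
    rw [Nat.choose_eq_zero_iff] at h3
    refine ⟨[], rfl, ?_, ?_⟩ <;>
    · simp only [run, Option.some.injEq, Fin.ext_iff]
      omega
  | succ r ih =>
    have h1 := j.2
    have h2 : i.val < j.val := hij
    have hi : i.val + 2 < n := by
      by_contra hi
      have : (n - 1 - i.val).choose 2 = 0 := Nat.choose_eq_zero_of_lt (by omega)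
      unfold remaining at hr
      omega
    by_cases hj : j.val + 1 < n
    · obtain ⟨w, hw, hwi, hwj⟩ := ih (i := i) (j := ⟨j.val + 1, hj⟩) (Fin.lt_def.2 (by simp; omega))
        (by have := remaining_succ (i := i.val) j.2; simp only; omega)
      refine ⟨.b i j hi hij :: w, by simp [hw], ?_, ?_⟩
      · rw [run, M_step_b_left hi hij hj]; exact hwi
      · rw [run, M_step_b_right hi hij hj]; exact hwj
    · have hj' : j.val = n - 1 := by omega
      obtain ⟨w, hw, hwi, hwj⟩ := ih (i := ⟨i.val + 1, by omega⟩) (j := ⟨i.val + 2, hi⟩)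
        (Fin.lt_def.2 (by simp))
        (by have := remaining_last hi; rw [hj'] at hr; simp only; omega)
      refine ⟨.b i j hi hij :: w, by simp [hw], ?_, ?_⟩
      · rw [run, M_step_b_left_last hi hij hj]; exact hwi
      · rw [run, M_step_b_right_last hi hij hj]; exact hwj

theorem M_not_actionTestable (hn : 2 < n) {k : ℕ} (hk : k ≤ n.choose 2) :
    ¬ (M n s F).ActionTestable k := by
  rintro ⟨-, h⟩
  have hpos : 0 < n.choose 2 := Nat.choose_pos hn.le
  obtain ⟨w, hw, hw0, hw1⟩ := M_exists_chain (s := s) (F := F) hn (n.choose 2 - 1)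
    (i := ⟨0, by omega⟩) (j := ⟨1, by omega⟩) (Fin.lt_def.2 Nat.zero_lt_one)
    (by rw [remaining_zero_one hn]; omega)
  have hi : (⟨0, by omega⟩ : Fin n).val + 2 < n := by simpa using hn
  have hij : (⟨0, by omega⟩ : Fin n) < ⟨n - 1, by omega⟩ := Fin.lt_def.2 (by simp; omega)
  -- In zero-based numbering, `g` takes `n - 1` through 2 to 0 and is undefined at `n - 2`. From
  -- state 1, `wgw` therefore ends at `n - 2`, where a second `g` fails; `w` has length `n.choose 2
  -- - 1`, just enough for `testEquiv_idem`.
  set g : List (Letter n) := [.b _ _ hi hij, .a] with hg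
  have hg1 : (M n s F).run ⟨n - 1, by omega⟩ g = some ⟨0, by omega⟩ := by
    rw [hg, run, M_step_b_right_last hi hij (by simp; omega), Option.bind_some, run,
      M_step_a rfl, Option.bind_some, run]
  have hg2 : (M n s F).run ⟨n - 2, by omega⟩ g = none := by
    rw [hg, run, M_step_b_eq_none hi hij (by simp [Fin.ext_iff]; omega)
      (by simp [Fin.ext_iff]; omega), Option.bind_none]
  have := h _ _ (by simp [hg]) (by simp [hg])
    (testEquiv_idem (e := w) (j := k) (by omega) g) ⟨1, by omega⟩
  simp only [run_append, hw1, Option.bind_some, hg1, hw0, hg2, Option.bind_none] at this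
  exact Option.some_ne_none _ this

theorem M_exists_run_of_le (hn : 2 < n) {k l : ℕ} (hkl : k ≤ l) (hl : l < n) :
    ∃ w, (M n s F).run ⟨k, by omega⟩ w = some ⟨l, hl⟩ := by
  induction l, hkl using Nat.le_induction with
  | base => exact ⟨[], rfl⟩
  | succ l hkl ih =>
    obtain ⟨w, hw⟩ := ih (by omega)
    have hi : (⟨0, by omega⟩ : Fin n).val + 2 < n := by simpa using hn
    obtain ⟨x, hx⟩ : ∃ x, (M n s F).step ⟨l, by omega⟩ x = some ⟨l + 1, hl⟩ := by
      rcases Nat.eq_zero_or_pos l with rfl | hpos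
      · exact ⟨.b ⟨0, by omega⟩ ⟨n - 1, by omega⟩ hi (Fin.lt_def.2 (by simp; omega)),
          M_step_b_left_last _ _ (by simp; omega)⟩
      · exact ⟨.b ⟨0, by omega⟩ ⟨l, by omega⟩ hi (Fin.lt_def.2 hpos), M_step_b_right _ _ hl⟩
    exact ⟨w ++ [x], by rw [run_append, hw, Option.bind_some, run, hx]; rfl⟩

theorem M_exists_run (hn : 2 < n) (p q : Fin n) : ∃ w, (M n s F).run p w = some q := by
  have hi : (⟨0, by omega⟩ : Fin n).val + 2 < n := by simpa using hn
  have hij : (⟨0, by omega⟩ : Fin n) < ⟨n - 1, by omega⟩ := Fin.lt_def.2 (by simp; omega)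
  obtain ⟨w, hw⟩ := M_exists_run_of_le (s := s) (F := F) hn (k := p) (l := n - 1)
    (by omega) (by omega)
  obtain ⟨w', hw'⟩ := M_exists_run_of_le (s := s) (F := F) hn (Nat.zero_le q) q.2
  refine ⟨w ++ (.b _ _ hi hij :: .a :: w'), ?_⟩
  rw [run_append, hw, Option.bind_some, run, M_step_b_right_last hi hij (by simp; omega),
    Option.bind_some, run, M_step_a rfl, Option.bind_some]
  exact hw'

/-- Some letter is defined on exactly one of two given states. -/
theorem M_exists_letter (hn : 2 < n) {p q : Fin n} (hpq : p < q) :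
    ∃ x p', (M n s F).step p x = some p' ∧ (M n s F).step q x = none := by
  have hi : (⟨0, by omega⟩ : Fin n).val + 2 < n := by simpa using hn
  have hlt : p.val < q.val := hpq
  rcases Nat.eq_zero_or_pos p.val with hp | hp
  · obtain ⟨p, hpn⟩ := p
    obtain rfl : p = 0 := hp
    obtain ⟨r, hr, hrq⟩ : ∃ r : Fin n, (⟨0, by omega⟩ : Fin n) < r ∧ q ≠ r := by
      by_cases hq : q.val = 1
      · exact ⟨⟨2, hn⟩, Fin.lt_def.2 (by simp), by simp [Fin.ext_iff, hq]⟩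
      · exact ⟨⟨1, by omega⟩, Fin.lt_def.2 (by simp), by simpa [Fin.ext_iff] using hq⟩
    refine ⟨.b _ r hi hr, ?_⟩
    by_cases h : r.val + 1 < n
    · exact ⟨_, M_step_b_left hi hr h, M_step_b_eq_none hi hr hpq.ne' hrq⟩
    · exact ⟨_, M_step_b_left_last hi hr h, M_step_b_eq_none hi hr hpq.ne' hrq⟩
  · have h0 : (⟨0, by omega⟩ : Fin n) < p := Fin.lt_def.2 hp
    exact ⟨.b _ p hi h0, _, M_step_b_right hi h0 (by omega),
      M_step_b_eq_none hi h0 (h0.trans hpq).ne' hpq.ne'⟩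

theorem M_acceptsFrom_nonempty (hn : 2 < n) (hF : F.Nonempty) (q : Fin n) :
    ((M n s F).acceptsFrom q).Nonempty := by
  obtain ⟨f, hf⟩ := hF
  obtain ⟨w, hw⟩ := M_exists_run (s := s) (F := F) hn q f
  exact ⟨w, f, hf, hw⟩

theorem M_isReduced (hn : 2 < n) (hF : F.Nonempty) : (M n s F).IsReduced := by
  refine ⟨M_exists_run hn s, fun p q h => ?_⟩
  have key : ∀ {p q : Fin n}, p < q → (M n s F).acceptsFrom p ≠ (M n s F).acceptsFrom q := by
    intro p q hpq h
    obtain ⟨x, p', hp, hq⟩ := M_exists_letter (s := s) (F := F) hn hpq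
    obtain ⟨y, f, hf, hy⟩ := M_acceptsFrom_nonempty (s := s) hn hF p'
    have h1 : x :: y ∈ (M n s F).acceptsFrom p := ⟨f, hf, by rw [run, hp]; exact hy⟩
    rw [h] at h1
    obtain ⟨f', -, h2⟩ := h1
    rw [run, hq] at h2
    exact Option.some_ne_none _ h2.symm
  rcases lt_trichotomy p q with hpq | hpq | hpq
  · exact (key hpq h).elim
  · exact hpq
  · exact (key hpq h.symm).elim

end LocalTestability

/-! ### The theorem. -/

theorem theorem6p3 (n : ℕ) (hn : 2 < n) (s : Fin n) (F : Set (Fin n)) (hF : F.Nonempty) :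
    (LocalTestability.M n s F).IsReduced ∧
    (LocalTestability.M n s F).LocallyTestable ∧
    (LocalTestability.M n s F).PreciselyTestable ((n ^ 2 - n) / 2 + 1) ∧
    (LocalTestability.M n s F).AcceptsLocallyTestable ∧
    (LocalTestability.M n s F).AcceptsPreciselyTestable ((n ^ 2 - n) / 2 + 1) ∧
    IsGreatest
      {k | ∃ (α : Type) (_ : Finite α) (A : LocalTestability.Automaton α (Fin n)),
        A.IsReduced ∧ A.PreciselyTestable k}
      ((n ^ 2 - n) / 2 + 1) ∧
    IsGreatest
      {k | ∃ (α : Type) (_ : Finite α) (A : LocalTestability.Automaton α (Fin n)),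
        A.IsReduced ∧ A.AcceptsPreciselyTestable k}
      ((n ^ 2 - n) / 2 + 1) := by
  open LocalTestability in
  have hK : (n ^ 2 - n) / 2 = n.choose 2 := by
    rw [Nat.choose_two_right, Nat.mul_sub_one, sq]
  rw [hK]
  have hred := M_isReduced (s := s) hn hF
  have htest : (M n s F).PreciselyTestable (n.choose 2 + 1) := by
    refine ⟨(Automaton.testable_iff _).2 M_actionTestable, fun k hk => ?_⟩
    by_contra hlt
    exact M_not_actionTestable hn (by omega) ((Automaton.testable_iff _).1 hk)
  -- `M` is strongly connected and `F` is nonempty, so there are no dead states to cut.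
  have htrim := Automaton.trim_eq_self (M_acceptsFrom_nonempty (s := s) hn hF)
  have hacc : (M n s F).AcceptsPreciselyTestable (n.choose 2 + 1) := by
    refine ⟨hred.acceptsTestable_iff.2 (htrim.symm ▸ M_actionTestable), fun k hk => ?_⟩
    by_contra hlt
    have := hred.acceptsTestable_iff.1 hk
    rw [htrim] at this
    exact M_not_actionTestable hn (by omega) this
  refine ⟨hred, ⟨_, htest.1⟩, htest, ⟨_, hacc.1⟩, hacc, ⟨?_, ?_⟩, ⟨?_, ?_⟩⟩
  · exact ⟨Letter n, inferInstance, M n s F, hred, htest⟩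
  · rintro k ⟨α, -, A, -, h⟩
    simpa using h.le_choose_two
  · exact ⟨Letter n, inferInstance, M n s F, hred, hacc⟩
  · rintro k ⟨α, -, A, hA, h⟩
    simpa using h.le_choose_two hA
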